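/- **Proposition (absolute convergence of $\mathcal Z(W_1,W_2,f;\mu_v,|\cdot|_v^{s_1},|\cdot|_v^{s_2})$).** Let $F_v$ be a local field of characteristic zero, with normalized absolute value $|\cdot|_v$ (the module of $F_v$), let $\psi=\mathbf e$ be a non-trivial continuous unitary additive character of $F_v$, and let $K_v\subset \mathrm{GL}_2(F_v)$ be the standard maximal compact subgroup ($\mathrm{GL}_2(\mathcal O_v)$, $\mathrm O(2)$ or $\mathrm U(2)$). Let $\pi_1,\pi_2$ be irreducible admissible representations of $\mathrm{GL}_2(F_v)$ with central characters satisfying $\omega_{\pi_1}\omega_{\pi_2}=1$ (smooth representations if $v$ is non-archimedean, Banach space representations if $v$ is archimedean). For $i=1,2$ let $W_i(g)=\lambda_i(\pi_i(g)w_i)$ be a Whittaker function of $\pi_i$ with respect to $\psi$: $w_i$ is a vector of $\pi_i$ (a smooth vector if $v$ is archimedean) and $\lambda_i$ is a linear functional on the space of smooth vectors (continuous for its Fréchet topology if $v$ is archimedean) with $$\lambda_i\bigl(\pi_i\begin{pmatrix}1&x\\&1\end{pmatrix}w\bigr)=\psi(x)\lambda_i(w)\qquad\text{for all } x\in F_v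 \text{ and all smooth vectors } w.$$ Let $\mu_v$ be a quasi-character of $F_v^\times$ (a continuous homomorphism $F_v^\times\to\mathbb C^\times$). For a Schwartz–Bruhat function $f$ on $\mathsf M_2(F_v)\times \mathsf M_2(F_v)$ and $s_1,s_2\in\mathbb C$ put $$\begin{aligned} \mathcal Z(W_1,W_2,f;\mu_v,|\cdot|_v^{s_1},|\cdot|_v^{s_2}) =&\int_{u,v\in F_v}\int_{\epsilon\in F_v^\times}\int_{K_v^2} f\Bigl(k_1^{-1}\begin{pmatrix}\epsilon^{-1}&\epsilon^{-1}v\\0&0\end{pmatrix}k_2,\;k_1^{-1}\begin{pmatrix}0&-u\epsilon\\0&\epsilon\end{pmatrix}k_2\Bigr)\,\omega_{\pi_2}(\epsilon)|\epsilon|_v^{2s_2-2}\\ &\times\Bigl(\int_{F_v^\times}W_1\bigl(\begin{pmatrix}\alpha\\&1\end{pmatrix}k_1\bigr)\mathbf e(u\alpha)\mu_v(\alpha)|\alpha|_v^{s_1-\frac12}\,d^\times\alpha\Bigr)\\ &\times\Bigl(\int_{F_v^\times}W_2\bigl(\begin{pmatrix}\beta\\&1\end{pmatrix}k_2\bigr)\mathbf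 e(v\beta)\mu_v^{-1}(\beta)|\beta|_v^{s_2-\frac12}\,d^\times\beta\Bigr)\,du\,dv\,d^\times\epsilon\,dk_1\,dk_2, \end{aligned}$$ where all measures are Haar measures. Then there is a real number $c$, depending on $W_1,W_2,\mu_v$ (and $\pi_1,\pi_2,\psi$) but not on $f$, $s_1$, $s_2$, such that for every Schwartz–Bruhat function $f$ and all $s_1,s_2\in\mathbb C$ with $\mathrm{Re}\,s_1>c$ and $\mathrm{Re}\,s_2>c$ the integral converges absolutely. That is: the integral over $\alpha$ converges absolutely for all $k_1\in K_v$, $u\in F_v$; the integral over $\beta$ converges absolutely for all $k_2\in K_v$, $v\in F_v$; the outer integral over $(u,v,\epsilon,k_1,k_2)$ converges absolutely; and the integrand in all the variables $(u,v,\epsilon,k_1,k_2,\alpha,\beta)$ together is absolutely integrable. -/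

import Mathlib

open MeasureTheory Matrix
open scoped SchwartzMap

noncomputable section

namespace ZetaTwo

/-! ### Group elements, quasi-characters, absolute value -/

section Local

variable {F : Type*} [Field F]

/-- The matrix `diag(a, 1)`. -/
def diagOne (a : Fˣ) : GL (Fin 2) F where
  val := !![(a : F), 0; 0, 1]
  inv := !![((a⁻¹ : Fˣ) : F), 0; 0, 1]
  val_inv := by simp [Matrix.one_fin_two]
  inv_val := by simp [Matrix.one_fin_two]

/-- The unipotent matrix `[1, x; 0, 1]`. -/
def unip (x : F) : GL (Fin 2) F := GeneralLinearGroup.upperRightHom x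

variable [TopologicalSpace F] [IsTopologicalRing F]

/-- The normalized absolute value `|a|_v`: the factor by which multiplication by `a` scales
additive Haar measure on `F`. -/
def normAbs [LocallyCompactSpace F] [MeasurableSpace F] [BorelSpace F] (a : Fˣ) : ℝ :=
  (distribHaarChar F a : ℝ)

/-- The quasi-character `a ↦ |a|_v ^ s`. -/
def absPow [LocallyCompactSpace F] [MeasurableSpace F] [BorelSpace F] (a : Fˣ) (s : ℂ) : ℂ :=
  (normAbs a : ℂ) ^ s

/-! ### Abstract Whittaker functions -/

/-- `ω` is the central character of `π`. -/
def IsCentralCharacter {V : Type*} [AddCommGroup V] [Module ℂ V]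
    (π : GL (Fin 2) F →* (V →ₗ[ℂ] V)) (ω : Fˣ →ₜ* ℂˣ) : Prop :=
  ∀ (z : Fˣ) (v : V), π (GeneralLinearGroup.scalar (Fin 2) z) v = ((ω z : ℂˣ) : ℂ) • v

/-- `ℓ (π (n(x)) v) = ψ(x) ℓ(v)` for all `x` and `v`. -/
def IsWhittakerFunctional {V : Type*} [AddCommGroup V] [Module ℂ V]
    (π : GL (Fin 2) F →* (V →ₗ[ℂ] V)) (ψ : AddChar F Circle) (ℓ : V →ₗ[ℂ] ℂ) : Prop :=
  ∀ (x : F) (v : V), ℓ (π (unip x) v) = (ψ x : ℂ) * ℓ v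

/-! ### The local zeta integral in two complex variables -/

variable [LocallyCompactSpace F] [MeasurableSpace F] [BorelSpace F]

/-- The integrand `W(diag(α,1) k) ψ(uα) χ(α) |α|^{s - 1/2}`. -/
def torusIntegrand (ψ : AddChar F Circle) (W : GL (Fin 2) F → ℂ) (χ : Fˣ →ₜ* ℂˣ) (s : ℂ)
    (k : GL (Fin 2) F) (u : F) (α : Fˣ) : ℂ :=
  W (diagOne α * k) * (ψ (u * α) : ℂ) * ((χ α : ℂˣ) : ℂ) * absPow α (s - 1 / 2)

/-- The weight
`f(k₁⁻¹ [ε⁻¹, ε⁻¹v; 0, 0] k₂, k₁⁻¹ [0, -uε; 0, ε] k₂) ω(ε) |ε|^{2 s₂ - 2}`. -/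
def schwartzWeight (f : Matrix (Fin 2) (Fin 2) F × Matrix (Fin 2) (Fin 2) F → ℂ)
    (ω : Fˣ →ₜ* ℂˣ) (s₂ : ℂ) (u v : F) (ε : Fˣ) (k₁ k₂ : GL (Fin 2) F) : ℂ :=
  f ((k₁⁻¹ : GL (Fin 2) F).val * !![(ε : F)⁻¹, (ε : F)⁻¹ * v; 0, 0] * k₂.val,
     (k₁⁻¹ : GL (Fin 2) F).val * !![0, -u * (ε : F); 0, (ε : F)] * k₂.val)
    * ((ω ε : ℂˣ) : ℂ) * absPow ε (2 * s₂ - 2)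

variable {K : Subgroup (GL (Fin 2) F)}

/-- The integrand of the outer integral over `(u, v, ε, k₁, k₂)`; the two inner integrals over
`Fˣ` are carried out. Here `ω` stands for the central character of the second representation. -/
def outerIntegrand (dt : Measure Fˣ) (ψ : AddChar F Circle) (ω μ : Fˣ →ₜ* ℂˣ)
    (W₁ W₂ : GL (Fin 2) F → ℂ)
    (f : Matrix (Fin 2) (Fin 2) F × Matrix (Fin 2) (Fin 2) F → ℂ) (s₁ s₂ : ℂ)
    (p : F × F × Fˣ × K × K) : ℂ :=
  schwartzWeight f ω s₂ p.1 p.2.1 p.2.2.1 p.2.2.2.1 p.2.2.2.2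
    * (∫ α, torusIntegrand ψ W₁ μ s₁ p.2.2.2.1 p.1 α ∂dt)
    * (∫ β, torusIntegrand ψ W₂ μ⁻¹ s₂ p.2.2.2.2 p.2.1 β ∂dt)

/-- The integrand in all variables `((u, v, ε, k₁, k₂), (α, β))`. -/
def fullIntegrand (ψ : AddChar F Circle) (ω μ : Fˣ →ₜ* ℂˣ)
    (W₁ W₂ : GL (Fin 2) F → ℂ)
    (f : Matrix (Fin 2) (Fin 2) F × Matrix (Fin 2) (Fin 2) F → ℂ) (s₁ s₂ : ℂ)
    (q : (F × F × Fˣ × K × K) × (Fˣ × Fˣ)) : ℂ :=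
  schwartzWeight f ω s₂ q.1.1 q.1.2.1 q.1.2.2.1 q.1.2.2.2.1 q.1.2.2.2.2
    * torusIntegrand ψ W₁ μ s₁ q.1.2.2.2.1 q.1.1 q.2.1
    * torusIntegrand ψ W₂ μ⁻¹ s₂ q.1.2.2.2.2 q.1.2.1 q.2.2

/-- The product measure `du dv d^×ε dk₁ dk₂`. -/
def outerMeasure [MeasurableSpace K] (dx : Measure F) (dt : Measure Fˣ) (dk : Measure K) :
    Measure (F × F × Fˣ × K × K) :=
  dx.prod (dx.prod (dt.prod (dk.prod dk)))

/-- Absolute convergence of the zeta integral `𝒵(W₁, W₂, f; μ, |·|^{s₁}, |·|^{s₂})`: every inner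
integral converges absolutely, the outer integral converges absolutely, and the integral over all
the variables together converges absolutely. -/
structure ZetaConvergesAbsolutely [MeasurableSpace K]
    (dx : Measure F) (dt : Measure Fˣ) (dk : Measure K)
    (ψ : AddChar F Circle) (ω μ : Fˣ →ₜ* ℂˣ) (W₁ W₂ : GL (Fin 2) F → ℂ)
    (f : Matrix (Fin 2) (Fin 2) F × Matrix (Fin 2) (Fin 2) F → ℂ) (s₁ s₂ : ℂ) : Prop where
  inner₁ : ∀ (k : K) (u : F), Integrable (torusIntegrand ψ W₁ μ s₁ k u) dt
  inner₂ : ∀ (k : K) (v : F), Integrable (torusIntegrand ψ W₂ μ⁻¹ s₂ k v) dt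
  outer : Integrable (outerIntegrand dt ψ ω μ W₁ W₂ f s₁ s₂) (outerMeasure dx dt dk)
  full : Integrable (fullIntegrand ψ ω μ W₁ W₂ f s₁ s₂)
    ((outerMeasure dx dt dk).prod (dt.prod dt))

end Local

/-! ### Non-archimedean places -/

section NonArch

variable (F : Type*) [NontriviallyNormedField F] [IsUltrametricDist F]

/-- `GL₂(𝒪)`: the elements `g` such that `g` and `g⁻¹` have entries in the ring of integers. -/
def integralGL : Subgroup (GL (Fin 2) F) where
  carrier := {g | (∀ i j, ‖g.val i j‖ ≤ 1) ∧ ∀ i j, ‖(g⁻¹ : GL (Fin 2) F).val i j‖ ≤ 1}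
  one_mem' := by
    constructor <;> intro i j <;> fin_cases i <;> fin_cases j <;> simp
  mul_mem' := by
    have key : ∀ A B : Matrix (Fin 2) (Fin 2) F, (∀ i j, ‖A i j‖ ≤ 1) → (∀ i j, ‖B i j‖ ≤ 1) →
        ∀ i j, ‖(A * B) i j‖ ≤ 1 := by
      intro A B hA hB i j
      rw [Matrix.mul_apply, Fin.sum_univ_two]
      refine (IsUltrametricDist.norm_add_le_max _ _).trans (max_le ?_ ?_) <;>
      · rw [norm_mul]
        exact mul_le_one₀ (hA _ _) (norm_nonneg _) (hB _ _)
    rintro a b ⟨ha, ha'⟩ ⟨hb, hb'⟩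
    refine ⟨?_, ?_⟩
    · rw [Units.val_mul]; exact key _ _ ha hb
    · rw [_root_.mul_inv_rev, Units.val_mul]; exact key _ _ hb' ha'
  inv_mem' := by
    rintro a ⟨ha, ha'⟩
    exact ⟨ha', by rw [inv_inv]; exact ha⟩

variable {F}

/-- Admissible smooth representation: every vector has an open stabilizer, and the vectors fixed
by an open subgroup form a finite-dimensional space. -/
structure IsAdmissibleNA {V : Type*} [AddCommGroup V] [Module ℂ V]
    (π : Representation ℂ (GL (Fin 2) F) V) : Prop where
  smooth : ∀ v : V, IsOpen {g : GL (Fin 2) F | π g v = v}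
  finite : ∀ U : Subgroup (GL (Fin 2) F), IsOpen (U : Set (GL (Fin 2) F)) →
    FiniteDimensional ℂ (Representation.invariants (π.comp U.subtype))

/-- The Whittaker functions of `π` with respect to `ψ`: the functions `g ↦ ℓ (π(g) v)` with `ℓ` a
Whittaker functional. -/
def whittakerNA {V : Type*} [AddCommGroup V] [Module ℂ V]
    (π : Representation ℂ (GL (Fin 2) F) V) (ψ : AddChar F Circle) :
    Set (GL (Fin 2) F → ℂ) :=
  {W | ∃ ℓ : V →ₗ[ℂ] ℂ, IsWhittakerFunctional π ψ ℓ ∧ ∃ v : V, W = fun g => ℓ (π g v)}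

/-- Schwartz–Bruhat functions: locally constant with compact support. -/
def IsSchwartzBruhatNA (f : Matrix (Fin 2) (Fin 2) F × Matrix (Fin 2) (Fin 2) F → ℂ) : Prop :=
  IsLocallyConstant f ∧ HasCompactSupport f

end NonArch

/-! ### Archimedean places -/

section Arch

variable (𝕜 : Type*) [RCLike 𝕜]

/-- The standard maximal compact subgroup: `O(2)` for `𝕜 = ℝ`, `U(2)` for `𝕜 = ℂ`. -/
def unitaryGL : Subgroup (GL (Fin 2) 𝕜) where
  carrier := {g | (g.val)ᴴ * g.val = 1}
  one_mem' := by simp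
  mul_mem' := by
    intro a b ha hb
    simp only [Set.mem_ofPred_eq, Units.val_mul, Matrix.conjTranspose_mul] at *
    calc (b.val)ᴴ * (a.val)ᴴ * (a.val * b.val)
        = (b.val)ᴴ * ((a.val)ᴴ * a.val) * b.val := by simp only [Matrix.mul_assoc]
      _ = 1 := by rw [ha, Matrix.mul_one, hb]
  inv_mem' := by
    intro a ha
    simp only [Set.mem_ofPred_eq] at *
    have h : (a⁻¹ : GL (Fin 2) 𝕜).val = (a.val)ᴴ := by
      have h2 : (a.val)ᴴ * a.val * (a⁻¹ : GL (Fin 2) 𝕜).val = (a⁻¹ : GL (Fin 2) 𝕜).val := by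
        rw [ha, Matrix.one_mul]
      rw [← h2, Matrix.mul_assoc, Units.mul_inv, Matrix.mul_one]
    rw [h, Matrix.conjTranspose_conjTranspose, ← h, Units.mul_inv]

variable {𝕜}
variable {H : Type*} [NormedAddCommGroup H] [NormedSpace ℂ H]

open Classical in
/-- The orbit map `g ↦ π(g) v` in matrix coordinates, extended by zero to singular matrices. -/
def orbitMap (π : GL (Fin 2) 𝕜 →* (H →L[ℂ] H)) (v : H) (x : Fin 2 → Fin 2 → 𝕜) : H :=
  if h : IsUnit (Matrix.of x) then π h.unit v else 0

/-- The open set of invertible matrices, in matrix coordinates. -/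
def invertibleSet (𝕜 : Type*) [RCLike 𝕜] : Set (Fin 2 → Fin 2 → 𝕜) :=
  {x | IsUnit (Matrix.of x)}

/-- The space `H^∞` of smooth vectors: those with a smooth orbit map. -/
def smoothVectors (π : GL (Fin 2) 𝕜 →* (H →L[ℂ] H)) : Submodule ℂ H where
  carrier := {v | ContDiffOn ℝ ((⊤ : ℕ∞) : WithTop ℕ∞) (orbitMap π v) (invertibleSet 𝕜)}
  zero_mem' := by
    have : orbitMap π (0 : H) = fun _ => 0 := by
      funext x; simp [orbitMap]
    simpa [this] using contDiffOn_const
  add_mem' := by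
    intro a b ha hb
    have : orbitMap π (a + b) = fun x => orbitMap π a x + orbitMap π b x := by
      funext x; by_cases h : IsUnit (Matrix.of x) <;> simp [orbitMap, h]
    simpa [this] using ha.add hb
  smul_mem' := by
    intro c a ha
    have : orbitMap π (c • a) = fun x => c • orbitMap π a x := by
      funext x; by_cases h : IsUnit (Matrix.of x) <;> simp [orbitMap, h]
    simpa [this] using ha.const_smul c

theorem smoothVectors_apply_mem (π : GL (Fin 2) 𝕜 →* (H →L[ℂ] H)) (g : GL (Fin 2) 𝕜)
    {v : H} (hv : v ∈ smoothVectors π) : π g v ∈ smoothVectors π := by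
  have hR : ContDiff ℝ ((⊤ : ℕ∞) : WithTop ℕ∞)
      (fun x : Fin 2 → Fin 2 → 𝕜 => fun i j => ∑ l, x i l * g.val l j) := by
    fun_prop
  have hof : ∀ x : Fin 2 → Fin 2 → 𝕜,
      Matrix.of (fun i j => ∑ l, x i l * g.val l j) = Matrix.of x * g.val := by
    intro x; ext i j; simp [Matrix.mul_apply]
  have hunit : ∀ x : Fin 2 → Fin 2 → 𝕜,
      IsUnit (Matrix.of (fun i j => ∑ l, x i l * g.val l j)) ↔ IsUnit (Matrix.of x) := by
    intro x; rw [hof]; exact Units.isUnit_mul_units _ g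
  have horb : orbitMap π (π g v) = orbitMap π v ∘
      (fun x : Fin 2 → Fin 2 → 𝕜 => fun i j => ∑ l, x i l * g.val l j) := by
    funext x
    by_cases h : IsUnit (Matrix.of x)
    · have h' := (hunit x).2 h
      have hu : h'.unit = h.unit * g := by
        ext1
        rw [Units.val_mul, IsUnit.unit_spec, IsUnit.unit_spec]
        exact hof x
      simp only [orbitMap, Function.comp, dif_pos h, dif_pos h', hu, map_mul]
      rfl
    · have h' : ¬ IsUnit (Matrix.of (fun i j => ∑ l, x i l * g.val l j)) :=
        fun hh => h ((hunit x).1 hh)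
      simp only [orbitMap, Function.comp, dif_neg h, dif_neg h']
  change ContDiffOn ℝ ((⊤ : ℕ∞) : WithTop ℕ∞) (orbitMap π (π g v)) (invertibleSet 𝕜)
  rw [horb]
  exact ContDiffOn.comp hv hR.contDiffOn (fun x hx => (hunit x).2 hx)

/-- The action of `GL₂(𝕜)` on the smooth vectors. -/
def smoothRep (π : GL (Fin 2) 𝕜 →* (H →L[ℂ] H)) :
    Representation ℂ (GL (Fin 2) 𝕜) (smoothVectors π) where
  toFun g := ((π g : H →L[ℂ] H) : H →ₗ[ℂ] H).restrict
    (fun _ hv => smoothVectors_apply_mem π g hv)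
  map_one' := by ext v; simp
  map_mul' a b := by ext v; simp

/-- The seminorms `‖D^j (g ↦ π(g) v) (1)‖` that define the Fréchet topology of `H^∞`. -/
def smoothSeminorm (π : GL (Fin 2) 𝕜 →* (H →L[ℂ] H)) (j : ℕ) (v : H) : ℝ :=
  ‖iteratedFDeriv ℝ j (orbitMap π v) (fun i l => (1 : Matrix (Fin 2) (Fin 2) 𝕜) i l)‖

/-- Continuity of a linear functional for the Fréchet topology of `H^∞`. -/
def IsSmoothContinuous (π : GL (Fin 2) 𝕜 →* (H →L[ℂ] H)) (ℓ : smoothVectors π →ₗ[ℂ] ℂ) : Prop :=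
  ∃ (N : ℕ) (C : ℝ), ∀ v : smoothVectors π,
    ‖ℓ v‖ ≤ C * ∑ j ∈ Finset.range (N + 1), smoothSeminorm π j v

/-- The sum of the images in `H` of all intertwining maps from the finite-dimensional
representation `τ` of the maximal compact subgroup. -/
def kIsotypic (π : GL (Fin 2) 𝕜 →* (H →L[ℂ] H)) {n : ℕ}
    (τ : unitaryGL 𝕜 →* GL (Fin n) ℂ) : Submodule ℂ H :=
  ⨆ T ∈ {T : (Fin n → ℂ) →ₗ[ℂ] H | ∀ (k : unitaryGL 𝕜) (x : Fin n → ℂ),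
    T ((τ k).val *ᵥ x) = π k (T x)}, LinearMap.range T

/-- Irreducible admissible representation of `GL₂(𝕜)` on a Banach space: strongly continuous,
without proper non-zero closed invariant subspaces, and with finite multiplicities of
the finite-dimensional continuous representations of the maximal compact subgroup. -/
structure IsIrreducibleAdmissibleArch (π : GL (Fin 2) 𝕜 →* (H →L[ℂ] H)) : Prop where
  continuous : ∀ v : H, Continuous fun g => π g v
  nontrivial : Nontrivial H
  irreducible : ∀ S : Submodule ℂ H, IsClosed (S : Set H) →
    (∀ g, ∀ v ∈ S, π g v ∈ S) → S = ⊥ ∨ S = ⊤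
  admissible : ∀ (n : ℕ) (τ : unitaryGL 𝕜 →* GL (Fin n) ℂ), Continuous τ →
    FiniteDimensional ℂ (kIsotypic π τ)

/-- `ω` is the central character of the Banach representation `π`. -/
def IsCentralCharacterArch (π : GL (Fin 2) 𝕜 →* (H →L[ℂ] H)) (ω : 𝕜ˣ →ₜ* ℂˣ) : Prop :=
  ∀ (z : 𝕜ˣ) (v : H), π (GeneralLinearGroup.scalar (Fin 2) z) v = ((ω z : ℂˣ) : ℂ) • v

/-- The Whittaker functions of `π` with respect to `ψ`: the functions `g ↦ ℓ (π(g) v)` with `v` a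
smooth vector and `ℓ` a continuous Whittaker functional on the space of smooth vectors. -/
def whittakerArch (π : GL (Fin 2) 𝕜 →* (H →L[ℂ] H)) (ψ : AddChar 𝕜 Circle) :
    Set (GL (Fin 2) 𝕜 → ℂ) :=
  {W | ∃ ℓ : smoothVectors π →ₗ[ℂ] ℂ, IsSmoothContinuous π ℓ ∧
    IsWhittakerFunctional (smoothRep π) ψ ℓ ∧
    ∃ v : smoothVectors π, W = fun g => ℓ (smoothRep π g v)}

/-- Schwartz functions on `M₂(𝕜) × M₂(𝕜)`, viewed as a real vector space. -/
def IsSchwartzArch (f : Matrix (Fin 2) (Fin 2) 𝕜 × Matrix (Fin 2) (Fin 2) 𝕜 → ℂ) : Prop :=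
  ∃ φ : 𝓢((Fin 2 → Fin 2 → 𝕜) × (Fin 2 → Fin 2 → 𝕜), ℂ),
    ∀ X Y, f (X, Y) = φ (Matrix.of.symm X, Matrix.of.symm Y)

end Arch

end ZetaTwo

end

/-! The variables decouple. Let m(a) = max(‖a‖, ‖a‖⁻¹) (`absMax`). The integrand in all variables is
dominated by a constant times (1+‖u‖)^(-P) (1+‖v‖)^(-P) m(ε)^(-P') m(α)^(-P') m(β)^(-P'), which is
integrable once P and P' are large because K is compact (`exists_integrable_one_add_norm`,
`exists_integrable_absMax`). The outer integral then follows from Fubini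
(`zetaConvergesAbsolutely_of_hasTorusDecay`).

The weight (`norm_schwartzWeight_le`): up to the bounded matrices k₁, k₂, the arguments of f have
the entries ε⁻¹, ε⁻¹v, uε, ε. These control ε, ε⁻¹, u = (uε)ε⁻¹ and v = ε(ε⁻¹v), so the rapid decay
of f absorbs every power of them, for every s₂.

The torus integrals (`norm_torusIntegrand_le`): it suffices that W(diag(a,1)k) grows at most like a
fixed power of ‖a‖⁻¹ at 0 and decays rapidly at infinity, uniformly in k. A large real part of s
beats the growth at 0, which determines c. This property of W is `HasTorusDecay`.

Non-archimedean W: it vanishes for large a because small unipotents fix the vector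
(`exists_torus_vanishing`). Near 0, the averages of the translates π(diag(pⁿ,1))v over a small
congruence subgroup lie in a finite-dimensional space, and averaging does not change the Whittaker
values at small a. A linear relation among the averages is therefore a linear recurrence for W,
which forces geometric, hence polynomial, growth (`exists_torus_recurrence`,
`norm_le_geometric_of_recurrence`).

Archimedean W: continuity of the functional and the action of the torus on the seminorms give
polynomial growth. For the decay, the M-fold difference with step h along the unipotent group
multiplies W(diag(a,1)k) by (ψ(ah)-1)^M (`whittaker_fwdDiff`), while it is O(‖h‖^M) in each seminorm
(`exists_norm_orbitDeriv_fwdDiff_le`). The step h = x₀/a with ψ(x₀) ≠ 1 gains any power of ‖a‖⁻¹. -/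

namespace ZetaTwo

open Filter Topology ENNReal Pointwise

section LocalField

variable {F : Type*} [NontriviallyNormedField F]

/-! ### The multiplicative group of a local field -/

/-- The size `max ‖a‖ ‖a‖⁻¹` of a unit of a normed field. -/
noncomputable def absMax (a : Fˣ) : ℝ := max ‖(a : F)‖ ‖(a : F)‖⁻¹

theorem norm_unit_pos (a : Fˣ) : 0 < ‖(a : F)‖ := norm_pos_iff.2 a.ne_zero

theorem one_le_absMax (a : Fˣ) : 1 ≤ absMax a := by
  rcases le_total 1 ‖(a : F)‖ with h | h
  · exact h.trans (le_max_left _ _)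
  · exact ((one_le_inv₀ (norm_unit_pos a)).2 h).trans (le_max_right _ _)

theorem absMax_pos (a : Fˣ) : 0 < absMax a := one_pos.trans_le (one_le_absMax a)

theorem absMax_of_one_le {a : Fˣ} (h : 1 ≤ ‖(a : F)‖) : absMax a = ‖(a : F)‖ :=
  max_eq_left ((inv_le_one_of_one_le₀ h).trans h)

theorem absMax_of_le_one {a : Fˣ} (h : ‖(a : F)‖ ≤ 1) : absMax a = ‖(a : F)‖⁻¹ :=
  max_eq_right (h.trans ((one_le_inv₀ (norm_unit_pos a)).2 h))

theorem absMax_inv (a : Fˣ) : absMax a⁻¹ = absMax a := by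
  simp only [absMax, Units.val_inv_eq_inv_val, norm_inv, inv_inv, max_comm]

theorem continuous_absMax : Continuous (absMax : Fˣ → ℝ) := by
  have h : Continuous fun a : Fˣ => ‖(a : F)‖ := Units.continuous_val.norm
  exact h.max (h.inv₀ fun a => (norm_unit_pos a).ne')

theorem continuous_diagOne : Continuous (diagOne : Fˣ → GL (Fin 2) F) := by
  rw [Units.continuous_iff]
  constructor <;> refine continuous_matrix fun i j => ?_
  · fin_cases i <;> fin_cases j <;> simp [diagOne] <;> fun_prop
  · fin_cases i <;> fin_cases j <;> simp only [diagOne] <;>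
      first
      | exact continuous_const
      | exact Units.continuous_val.comp continuous_inv

theorem diagOne_mul (a b : Fˣ) : diagOne (a * b) = diagOne a * diagOne b := by
  ext i j
  fin_cases i <;> fin_cases j <;> simp [diagOne]

theorem diagOne_one : diagOne (1 : Fˣ) = 1 := by
  ext i j
  fin_cases i <;> fin_cases j <;> simp [diagOne]

theorem diagOne_mul_unip (a : Fˣ) (x : F) : diagOne a * unip x = unip (a * x) * diagOne a := by
  ext i j
  fin_cases i <;> fin_cases j <;>
    simp [diagOne, unip, GeneralLinearGroup.upperRightHom, Matrix.mul_apply]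

theorem smul_closedBall_one (a : Fˣ) :
    a • Metric.closedBall (0 : F) 1 = Metric.closedBall 0 ‖(a : F)‖ := by
  ext x
  rw [Set.mem_smul_set_iff_inv_smul_mem, mem_closedBall_zero_iff, mem_closedBall_zero_iff,
    Units.smul_def, smul_eq_mul, norm_mul, Units.val_inv_eq_inv_val, norm_inv,
    inv_mul_le_one₀ (norm_unit_pos a)]

theorem exists_unit_norm_lt_one (F : Type*) [NontriviallyNormedField F] :
    ∃ q : Fˣ, ‖(q : F)‖ < 1 := by
  obtain ⟨x, hx0, hx⟩ := NormedField.exists_norm_lt_one F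
  exact ⟨Units.mk0 x (norm_pos_iff.1 hx0), hx⟩

/-- Any contracting q does the work of a uniformizer, over ℝ and ℂ as well: multiplicative estimates
reduce to the compact annulus ‖q‖ ≤ ‖u‖ ≤ 1 and to the single element q. -/
theorem exists_eq_mul_pow {q : Fˣ} (hq : ‖(q : F)‖ < 1) {a : Fˣ} (ha : ‖(a : F)‖ ≤ 1) :
    ∃ (u : Fˣ) (n : ℕ), ‖(q : F)‖ ≤ ‖(u : F)‖ ∧ ‖(u : F)‖ ≤ 1 ∧ a = u * q ^ n := by
  obtain ⟨n, hn1, hn2⟩ := exists_nat_pow_near_of_lt_one (norm_unit_pos a) ha (norm_unit_pos q) hq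
  have hpos : 0 < ‖(q : F)‖ ^ n := pow_pos (norm_unit_pos q) n
  refine ⟨a * (q ^ n)⁻¹, n, ?_, ?_, by simp⟩
  · simp only [Units.val_mul, Units.val_inv_eq_inv_val, Units.val_pow_eq_pow_val, norm_mul,
      norm_inv, norm_pow]
    rw [← div_eq_mul_inv, le_div_iff₀ hpos, ← pow_succ']
    exact hn1.le
  · simp only [Units.val_mul, Units.val_inv_eq_inv_val, Units.val_pow_eq_pow_val, norm_mul,
      norm_inv, norm_pow]
    rw [← div_eq_mul_inv, div_le_one hpos]
    exact hn2

variable [ProperSpace F]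

theorem isCompact_annulus {r R : ℝ} (hr : 0 < r) :
    IsCompact {a : Fˣ | r ≤ ‖(a : F)‖ ∧ ‖(a : F)‖ ≤ R} := by
  rw [Units.isEmbedding_val₀.isCompact_iff]
  have himg : ((↑) : Fˣ → F) '' {a : Fˣ | r ≤ ‖(a : F)‖ ∧ ‖(a : F)‖ ≤ R} =
      Metric.closedBall 0 R ∩ {x | r ≤ ‖x‖} := by
    ext x
    simp only [Set.mem_image, Set.mem_ofPred_eq, Set.mem_inter_iff, mem_closedBall_zero_iff]
    constructor
    · rintro ⟨a, ⟨h1, h2⟩, rfl⟩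
      exact ⟨h2, h1⟩
    · rintro ⟨h2, h1⟩
      exact ⟨Units.mk0 x (norm_pos_iff.1 (hr.trans_le h1)), ⟨h1, h2⟩, rfl⟩
  rw [himg]
  exact (isCompact_closedBall 0 R).inter_right (isClosed_le continuous_const continuous_norm)

/-- Writing a = u qⁿ gives φ(a) ≤ φ(q)ⁿ sup φ over the annulus, and A is taken so large that φ(q) <
‖q‖^(-A). -/
theorem submultiplicative_le_inv_pow {φ : Fˣ → ℝ} (h0 : ∀ a, 0 ≤ φ a)
    (hmul : ∀ a b, φ (a * b) ≤ φ a * φ b)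
    (hbdd : ∀ S : Set Fˣ, IsCompact S → ∃ C, ∀ a ∈ S, φ a ≤ C) :
    ∃ (C : ℝ) (A : ℕ), 0 ≤ C ∧ ∀ a : Fˣ, ‖(a : F)‖ ≤ 1 → φ a ≤ C * (‖(a : F)‖⁻¹) ^ A := by
  obtain ⟨q, hq⟩ := exists_unit_norm_lt_one F
  have hq0 := norm_unit_pos q
  obtain ⟨S, hS⟩ := hbdd _ (isCompact_annulus (R := 1) hq0)
  have hS0 : 0 ≤ S := (h0 1).trans (hS 1 ⟨by simpa using hq.le, by simp⟩)
  obtain ⟨A, hA⟩ := pow_unbounded_of_one_lt (φ q) ((one_lt_inv₀ hq0).2 hq)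
  refine ⟨S, A, hS0, fun a ha => ?_⟩
  obtain ⟨u, n, hu1, hu2, rfl⟩ := exists_eq_mul_pow hq ha
  have hpow : ∀ n : ℕ, φ (u * q ^ n) ≤ S * φ q ^ n := by
    intro n
    induction n with
    | zero => simpa using hS u ⟨hu1, hu2⟩
    | succ n ih =>
      rw [pow_succ, ← mul_assoc, pow_succ, ← mul_assoc]
      exact (hmul _ _).trans (mul_le_mul_of_nonneg_right ih (h0 q))
  refine (hpow n).trans (mul_le_mul_of_nonneg_left ?_ hS0)
  calc φ q ^ n ≤ ((‖(q : F)‖⁻¹) ^ A) ^ n := pow_le_pow_left₀ (h0 q) hA.le n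
    _ = ((‖(q : F)‖ ^ n)⁻¹) ^ A := by rw [← inv_pow, ← pow_mul, ← pow_mul, mul_comm]
    _ ≤ _ := by
      have hp := norm_unit_pos (u * q ^ n)
      gcongr
      · simp only [Units.val_mul, Units.val_pow_eq_pow_val, norm_mul, norm_pow]
        exact mul_le_of_le_one_left (by positivity) hu2

/-- Submultiplicative, locally bounded functions on `Fˣ` grow at most polynomially. -/
theorem submultiplicative_le_absMax_pow {φ : Fˣ → ℝ} (h0 : ∀ a, 0 ≤ φ a)
    (hmul : ∀ a b, φ (a * b) ≤ φ a * φ b)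
    (hbdd : ∀ S : Set Fˣ, IsCompact S → ∃ C, ∀ a ∈ S, φ a ≤ C) :
    ∃ (C : ℝ) (A : ℕ), 0 ≤ C ∧ ∀ a : Fˣ, φ a ≤ C * absMax a ^ A := by
  obtain ⟨C, A, hC, h⟩ := submultiplicative_le_inv_pow h0 hmul hbdd
  obtain ⟨C', A', hC', h'⟩ := submultiplicative_le_inv_pow (φ := fun a => φ a⁻¹) (fun a => h0 _)
    (fun a b => by rw [mul_inv]; exact hmul _ _) (fun S hS => by
      obtain ⟨C, hC⟩ := hbdd (Inv.inv '' S) (hS.image continuous_inv)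
      exact ⟨C, fun a ha => hC _ ⟨a, ha, rfl⟩⟩)
  refine ⟨max C C', max A A', le_max_of_le_left hC, fun a => ?_⟩
  rcases le_total ‖(a : F)‖ 1 with ha | ha
  · refine (h a ha).trans ?_
    rw [← absMax_of_le_one ha]
    have := absMax_pos a
    gcongr
    · exact le_max_left _ _
    · exact one_le_absMax a
    · exact le_max_left _ _
  · have ha' : ‖((a⁻¹ : Fˣ) : F)‖ ≤ 1 := by
      rw [Units.val_inv_eq_inv_val, norm_inv]; exact inv_le_one_of_one_le₀ ha
    have := h' a⁻¹ ha'
    rw [inv_inv, ← absMax_of_le_one ha', absMax_inv] at this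
    refine this.trans ?_
    have := absMax_pos a
    gcongr
    · exact le_max_right _ _
    · exact one_le_absMax a
    · exact le_max_right _ _

/-! ### The normalized absolute value and growth of Haar measure -/

variable [MeasurableSpace F] [BorelSpace F]

/-- The σ-algebra of the units is pulled back from F, and over a topological field the inclusion of
the units is an embedding. -/
instance borelSpace_units : BorelSpace Fˣ where
  measurable_eq := by
    rw [Units.isEmbedding_val₀.eq_induced, borel_comap, ← BorelSpace.measurable_eq (α := F)]
    rfl

instance secondCountableTopology_units : SecondCountableTopology Fˣ :=
  Units.isEmbedding_val₀.secondCountableTopology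

theorem normAbs_pos (a : Fˣ) : 0 < normAbs a := distribHaarChar_pos

theorem normAbs_mul (a b : Fˣ) : normAbs (a * b) = normAbs a * normAbs b := by
  simp [normAbs]

theorem normAbs_pow (a : Fˣ) (n : ℕ) : normAbs (a ^ n) = normAbs a ^ n := by
  simp [normAbs]

/-- The link between the given norm and the module: the norm need not be normalized, and both must
be compared on balls. -/
theorem measure_closedBall_norm (dx : Measure F) [dx.IsAddHaarMeasure] (a : Fˣ) :
    dx (Metric.closedBall 0 ‖(a : F)‖) =
      ENNReal.ofReal (normAbs a) * dx (Metric.closedBall 0 1) := by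
  rw [← smul_closedBall_one, ← distribHaarChar_mul]
  simp [normAbs]

/-- Otherwise the balls of radius ‖q‖ⁿ all have at least the measure of the unit ball, although they
shrink to a point, which is null. -/
theorem normAbs_lt_one {q : Fˣ} (hq : ‖(q : F)‖ < 1) : normAbs q < 1 := by
  let dx : Measure F := Measure.addHaar
  by_contra! h
  have hB : dx (Metric.closedBall 0 1) ≠ ∞ := (isCompact_closedBall 0 1).measure_ne_top
  have hB0 : 0 < dx (Metric.closedBall 0 1) := Metric.measure_closedBall_pos _ _ one_pos
  have hlim : Tendsto (fun n : ℕ => dx (Metric.closedBall (0 : F) (‖(q : F)‖ ^ n))) atTop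
      (𝓝 (dx (⋂ n : ℕ, Metric.closedBall (0 : F) (‖(q : F)‖ ^ n)))) := by
    refine tendsto_measure_iInter_atTop (fun n => Metric.isClosed_closedBall.nullMeasurableSet) ?_
      ⟨0, by simpa using hB⟩
    intro m n hmn
    exact Metric.closedBall_subset_closedBall
      (pow_le_pow_of_le_one (norm_nonneg _) hq.le hmn)
  have hinter : ⋂ n : ℕ, Metric.closedBall (0 : F) (‖(q : F)‖ ^ n) = {0} := by
    ext x
    simp only [Set.mem_iInter, mem_closedBall_zero_iff, Set.mem_singleton_iff]
    constructor
    · intro hx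
      have := ge_of_tendsto' (tendsto_pow_atTop_nhds_zero_of_lt_one (norm_nonneg _) hq) hx
      simpa using this
    · rintro rfl n
      simp
  rw [hinter, measure_singleton] at hlim
  refine (ge_of_tendsto' hlim fun n => ?_).not_gt hB0
  have := measure_closedBall_norm dx (q ^ n)
  simp only [Units.val_pow_eq_pow_val, norm_pow] at this
  rw [this, normAbs_pow]
  refine le_mul_of_one_le_left zero_le ?_
  rw [ENNReal.one_le_ofReal]
  exact one_le_pow₀ h

theorem normAbs_le_of_norm_le (dx : Measure F) [dx.IsAddHaarMeasure] {a : Fˣ} {r : ℝ}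
    (h : ‖(a : F)‖ ≤ r) :
    normAbs a ≤ (dx (Metric.closedBall 0 r)).toReal / (dx (Metric.closedBall 0 1)).toReal := by
  have hB : ∀ r, dx (Metric.closedBall 0 r) ≠ ∞ := fun r =>
    (isCompact_closedBall 0 r).measure_ne_top
  have hB0 : 0 < dx (Metric.closedBall 0 1) := Metric.measure_closedBall_pos _ _ one_pos
  rw [le_div_iff₀ (ENNReal.toReal_pos hB0.ne' (hB 1))]
  have h1 := measure_mono (μ := dx) (Metric.closedBall_subset_closedBall (x := 0) h)
  rw [measure_closedBall_norm] at h1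
  have := ENNReal.toReal_mono (hB r) h1
  rwa [ENNReal.toReal_mul, ENNReal.toReal_ofReal (normAbs_pos a).le] at this

/-- The measure of a closed ball is continuous from the right in the radius, which bounds the module
from above near 1. Inversion gives the lower bound, and multiplicativity moves continuity at 1 to
every point. -/
theorem continuous_normAbs : Continuous (normAbs : Fˣ → ℝ) := by
  let dx : Measure F := Measure.addHaar
  have hB : ∀ r, dx (Metric.closedBall 0 r) ≠ ∞ := fun r =>
    (isCompact_closedBall 0 r).measure_ne_top
  have hB0 : 0 < dx (Metric.closedBall 0 1) := Metric.measure_closedBall_pos _ _ one_pos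
  have hB1 := ENNReal.toReal_pos hB0.ne' (hB 1)
  have hone : Tendsto (normAbs : Fˣ → ℝ) (𝓝 1) (𝓝 1) := by
    -- an upper bound that holds near `1` and, after inversion, gives a lower bound as well
    have hup : ∀ η > 1, ∀ᶠ a : Fˣ in 𝓝 1, normAbs a ≤ η := by
      intro η hη
      have hlim : Tendsto (fun n : ℕ => dx (Metric.closedBall (0 : F) (1 + 1 / ((n : ℝ) + 1))))
          atTop (𝓝 (dx (⋂ n : ℕ, Metric.closedBall (0 : F) (1 + 1 / ((n : ℝ) + 1))))) := by
        refine tendsto_measure_iInter_atTop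
          (fun n => Metric.isClosed_closedBall.nullMeasurableSet) ?_ ⟨0, hB _⟩
        intro m n hmn
        refine Metric.closedBall_subset_closedBall ?_
        have : (m : ℝ) ≤ n := by exact_mod_cast hmn
        gcongr
      have hinter : ⋂ n : ℕ, Metric.closedBall (0 : F) (1 + 1 / ((n : ℝ) + 1)) =
          Metric.closedBall 0 1 := by
        ext x
        simp only [Set.mem_iInter, mem_closedBall_zero_iff]
        constructor
        · intro hx
          have h1 : Tendsto (fun n : ℕ => 1 + 1 / ((n : ℝ) + 1)) atTop (𝓝 (1 + 0)) :=
            tendsto_const_nhds.add tendsto_one_div_add_atTop_nhds_zero_nat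
          simpa using ge_of_tendsto' h1 hx
        · intro hx n
          exact hx.trans (by simp; positivity)
      rw [hinter] at hlim
      have hlim2 := (((ENNReal.tendsto_toReal (hB 1)).comp hlim).div_const
        (dx (Metric.closedBall (0 : F) 1)).toReal)
      rw [div_self hB1.ne'] at hlim2
      obtain ⟨n, hn⟩ := (hlim2.eventually (gt_mem_nhds hη)).exists
      have hnear : ∀ᶠ a : Fˣ in 𝓝 1, ‖(a : F)‖ < 1 + 1 / ((n : ℝ) + 1) := by
        refine (Units.continuous_val.norm.tendsto (1 : Fˣ)).eventually (gt_mem_nhds ?_)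
        simp; positivity
      filter_upwards [hnear] with a ha
      exact (normAbs_le_of_norm_le dx ha.le).trans hn.le
    have hinv : ∀ a : Fˣ, normAbs a⁻¹ = (normAbs a)⁻¹ := fun a => by simp [normAbs]
    refine tendsto_order.2 ⟨fun b hb => ?_, fun b hb => ?_⟩
    · obtain ⟨c, hc1, hc2⟩ : ∃ c, 1 < c ∧ b < c⁻¹ := by
        obtain ⟨d, hd1, hd2⟩ := exists_between (max_lt hb one_pos)
        have hd0 : 0 < d := (le_max_right _ _).trans_lt hd1
        exact ⟨d⁻¹, (one_lt_inv₀ hd0).2 hd2, by rw [inv_inv]; exact (le_max_left _ _).trans_lt hd1⟩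
      have h1 := hup c hc1
      have h2 : Tendsto (fun a : Fˣ => a⁻¹) (𝓝 1) (𝓝 1) := by
        simpa using (continuous_inv (G := Fˣ)).tendsto 1
      filter_upwards [h2.eventually h1] with a ha
      rw [hinv] at ha
      exact hc2.trans_le (inv_le_of_inv_le₀ (normAbs_pos a) ha)
    · obtain ⟨d, hd1, hd2⟩ := exists_between hb
      filter_upwards [hup d hd1] with a ha
      exact ha.trans_lt hd2
  let χ : Fˣ →* ℝ :=
    { toFun := normAbs, map_one' := by simp [normAbs], map_mul' := normAbs_mul }
  refine continuous_iff_continuousAt.2 fun a => ?_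
  have h2 : Tendsto (fun b : Fˣ => a⁻¹ * b) (𝓝 a) (𝓝 1) := by
    simpa using (continuous_const_mul a⁻¹).tendsto a
  have h3 := (hone.comp h2).const_mul (normAbs a)
  simp only [Function.comp_def, ← normAbs_mul, mul_inv_cancel_left, mul_one] at h3
  exact h3

/-- This converts a large exponent of the module into powers of the norm near 0. The exponent A is
one for which the module of q, raised to A, lies below ‖q‖. -/
theorem exists_normAbs_pow_le :
    ∃ (A : ℕ) (C : ℝ), 1 ≤ C ∧ ∀ a : Fˣ, ‖(a : F)‖ ≤ 1 →
      normAbs a ≤ C ∧ normAbs a ^ A ≤ C * ‖(a : F)‖ := by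
  obtain ⟨q, hq⟩ := exists_unit_norm_lt_one F
  have hq0 := norm_unit_pos q
  obtain ⟨S, hS⟩ := (isCompact_annulus (F := F) (R := 1) hq0).bddAbove_image
    continuous_normAbs.continuousOn
  have hS' : ∀ u : Fˣ, ‖(q : F)‖ ≤ ‖(u : F)‖ → ‖(u : F)‖ ≤ 1 → normAbs u ≤ S :=
    fun u h1 h2 => hS ⟨u, ⟨h1, h2⟩, rfl⟩
  have hS1 : 1 ≤ S := by simpa [normAbs] using hS' 1 (by simpa using hq.le) (by simp)
  obtain ⟨A, hA⟩ := exists_pow_lt_of_lt_one hq0 (normAbs_lt_one hq)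
  have hSA : 1 ≤ S ^ A := one_le_pow₀ hS1
  have hqi : 1 ≤ ‖(q : F)‖⁻¹ := (one_le_inv₀ hq0).2 hq.le
  refine ⟨A, max S (S ^ A * ‖(q : F)‖⁻¹), le_max_of_le_left hS1, fun a ha => ?_⟩
  obtain ⟨u, n, hu1, hu2, rfl⟩ := exists_eq_mul_pow hq ha
  have hn1 : normAbs q ^ n ≤ 1 := pow_le_one₀ (normAbs_pos q).le (normAbs_lt_one hq).le
  rw [normAbs_mul, normAbs_pow]
  constructor
  · refine le_max_of_le_left ?_
    exact (mul_le_of_le_one_right (normAbs_pos u).le hn1).trans (hS' u hu1 hu2)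
  · calc (normAbs u * normAbs q ^ n) ^ A = normAbs u ^ A * (normAbs q ^ A) ^ n := by
          rw [mul_pow, ← pow_mul, ← pow_mul, mul_comm n]
      _ ≤ S ^ A * ‖(q : F)‖ ^ n := by
          gcongr
          · exact pow_nonneg (pow_nonneg (normAbs_pos q).le _) _
          · exact (normAbs_pos u).le
          · exact hS' u hu1 hu2
          · exact pow_nonneg (normAbs_pos q).le _
      _ = S ^ A * ‖(q : F)‖⁻¹ * (‖(q : F)‖ * ‖(q : F)‖ ^ n) := by field_simp
      _ ≤ max S (S ^ A * ‖(q : F)‖⁻¹) * ‖((u * q ^ n : Fˣ) : F)‖ := by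
          simp only [Units.val_mul, Units.val_pow_eq_pow_val, norm_mul, norm_pow]
          gcongr
          exact le_max_right _ _

end LocalField

/-! ### Integrability of inverse powers on F and on its unit group -/

/-- A function with polynomially growing sublevel sets has integrable inverse powers. -/
theorem exists_integrable_inv_pow {X : Type*} [MeasurableSpace X] {ν : Measure X} {N : X → ℝ}
    (hN : Measurable N) (h1 : ∀ x, 1 ≤ N x) {R : ℝ} (hR : 1 < R) {C Q : ℝ} (hC : 0 ≤ C)
    (hQ : 0 ≤ Q) (h : ∀ n : ℕ, ν {x | N x ≤ R ^ n} ≤ ENNReal.ofReal (C * Q ^ n)) :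
    ∃ P : ℕ, Integrable (fun x => (N x)⁻¹ ^ P) ν := by
  -- With 2Q < R^P the shells Rⁿ ≤ N < Rⁿ⁺¹ contribute a series dominated by a geometric one of
  -- ratio 1/2.
  obtain ⟨P, hP⟩ := pow_unbounded_of_one_lt (2 * Q) hR
  have hR0 : 0 < R := one_pos.trans hR
  refine ⟨P, (hN.inv.pow_const P).aestronglyMeasurable, ?_⟩
  set t : ℕ → ℝ := fun n => (R⁻¹ ^ n) ^ P with ht
  have ht0 : ∀ n, 0 ≤ t n := fun n => by positivity
  have hpt : ∀ x, ‖(N x)⁻¹ ^ P‖ₑ ≤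
      ∑' n : ℕ, Set.indicator {x | N x ≤ R ^ (n + 1)} (fun _ => ENNReal.ofReal (t n)) x := by
    intro x
    obtain ⟨n, hn1, hn2⟩ := exists_nat_pow_near (h1 x) hR
    refine le_trans ?_ (ENNReal.le_tsum n)
    rw [Set.indicator_of_mem (show x ∈ {x | N x ≤ R ^ (n + 1)} from hn2.le),
      Real.enorm_eq_ofReal (pow_nonneg (inv_nonneg.2 (zero_le_one.trans (h1 x))) _)]
    refine ENNReal.ofReal_le_ofReal ?_
    simp only [ht, inv_pow]
    gcongr
  refine lt_of_le_of_lt (lintegral_mono hpt) ?_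
  have hmeas : ∀ n : ℕ, MeasurableSet {x | N x ≤ R ^ (n + 1)} := fun n =>
    measurableSet_le hN measurable_const
  rw [lintegral_tsum fun n => (measurable_const.indicator (hmeas n)).aemeasurable]
  have hterm : ∀ n : ℕ, ∫⁻ x, Set.indicator {x | N x ≤ R ^ (n + 1)}
      (fun _ => ENNReal.ofReal (t n)) x ∂ν ≤ ENNReal.ofReal (C * Q * (1 / 2) ^ n) := by
    intro n
    rw [lintegral_indicator_const (hmeas n)]
    refine (mul_le_mul_right (h (n + 1)) _).trans ?_
    rw [← ENNReal.ofReal_mul (ht0 n)]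
    refine ENNReal.ofReal_le_ofReal ?_
    have : t n * (C * Q ^ (n + 1)) = C * Q * (Q * (R ^ P)⁻¹) ^ n := by
      simp only [ht, inv_pow, mul_pow, ← pow_mul, mul_comm P n, pow_succ]
      ring
    rw [this]
    have hle : Q * (R ^ P)⁻¹ ≤ 1 / 2 := by
      rw [← div_eq_mul_inv, div_le_iff₀ (pow_pos hR0 P)]
      linarith
    gcongr
  refine (ENNReal.tsum_le_tsum hterm).trans_lt ?_
  rw [← ENNReal.ofReal_tsum_of_nonneg (fun n => by positivity)
    (summable_geometric_two.mul_left (C * Q))]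
  exact ENNReal.ofReal_lt_top

section LocalField

variable {F : Type*} [NontriviallyNormedField F] [ProperSpace F] [MeasurableSpace F] [BorelSpace F]

/-- The ball of radius ‖q⁻¹‖ⁿ has measure proportional to the n-th power of the module of q⁻¹, so
sublevel sets grow geometrically. -/
theorem exists_integrable_one_add_norm (dx : Measure F) [dx.IsAddHaarMeasure] :
    ∃ P : ℕ, Integrable (fun u : F => (1 + ‖u‖)⁻¹ ^ P) dx := by
  obtain ⟨q, hq⟩ := exists_unit_norm_lt_one F
  have hR : 1 < ‖((q⁻¹ : Fˣ) : F)‖ := by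
    rw [Units.val_inv_eq_inv_val, norm_inv]; exact (one_lt_inv₀ (norm_unit_pos q)).2 hq
  refine exists_integrable_inv_pow (N := fun u : F => 1 + ‖u‖)
    (by fun_prop) (fun u => by simp) hR
    (C := (dx (Metric.closedBall 0 1)).toReal) ENNReal.toReal_nonneg
    (normAbs_pos q⁻¹).le fun n => ?_
  have hB : dx (Metric.closedBall 0 1) ≠ ∞ := (isCompact_closedBall 0 1).measure_ne_top
  have hsub : {u : F | 1 + ‖u‖ ≤ ‖((q⁻¹ : Fˣ) : F)‖ ^ n} ⊆
      Metric.closedBall 0 ‖((q⁻¹ ^ n : Fˣ) : F)‖ := by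
    intro u hu
    rw [mem_closedBall_zero_iff, Units.val_pow_eq_pow_val, norm_pow]
    exact (le_add_of_nonneg_left zero_le_one).trans hu
  refine (measure_mono hsub).trans ?_
  rw [measure_closedBall_norm, normAbs_pow, ENNReal.ofReal_mul ENNReal.toReal_nonneg,
    ENNReal.ofReal_toReal hB, mul_comm]

/-- The n-th sublevel set is covered by 2(n+1) multiplicative translates of one compact annulus. Its
measure grows only linearly in n, and n + 1 ≤ 2ⁿ puts this in geometric form. -/
theorem exists_integrable_absMax (dt : Measure Fˣ) [dt.IsHaarMeasure] :
    ∃ P : ℕ, Integrable (fun a : Fˣ => (absMax a)⁻¹ ^ P) dt := by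
  obtain ⟨q, hq⟩ := exists_unit_norm_lt_one F
  have hq0 := norm_unit_pos q
  have hR : 1 < ‖(q : F)‖⁻¹ := (one_lt_inv₀ hq0).2 hq
  set S : Set Fˣ := {a : Fˣ | ‖(q : F)‖ ≤ ‖(a : F)‖ ∧ ‖(a : F)‖ ≤ ‖(q : F)‖⁻¹} with hS
  have hSc : IsCompact S := isCompact_annulus hq0
  refine exists_integrable_inv_pow (N := absMax) continuous_absMax.measurable one_le_absMax hR
    (C := 2 * (dt S).toReal) (Q := 2) (by positivity) (by norm_num) fun n => ?_
  have hsub : {a : Fˣ | absMax a ≤ ‖(q : F)‖⁻¹ ^ n} ⊆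
      (⋃ m ∈ Finset.range (n + 1), (fun a => (q ^ m)⁻¹ * a) ⁻¹' S) ∪
      (⋃ m ∈ Finset.range (n + 1), (fun a => q ^ m * a) ⁻¹' S) := by
    have key : ∀ b : Fˣ, ‖(b : F)‖ ≤ 1 → absMax b ≤ ‖(q : F)‖⁻¹ ^ n →
        ∃ m ∈ Finset.range (n + 1), (q ^ m)⁻¹ * b ∈ S := by
      intro b hb hbn
      obtain ⟨u, m, hu1, hu2, rfl⟩ := exists_eq_mul_pow hq hb
      refine ⟨m, ?_, ?_⟩
      · rw [absMax_of_le_one hb] at hbn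
        simp only [Units.val_mul, Units.val_pow_eq_pow_val, norm_mul, norm_pow] at hbn
        have h1 : ‖(q : F)‖⁻¹ ^ m ≤ ‖(q : F)‖⁻¹ ^ n := by
          refine le_trans ?_ hbn
          rw [inv_pow]
          have := mul_pos (norm_unit_pos u) (pow_pos hq0 m)
          gcongr
          exact mul_le_of_le_one_left (by positivity) hu2
        rw [Finset.mem_range]
        exact Nat.lt_succ_of_le ((pow_le_pow_iff_right₀ hR).1 h1)
      · have : (q ^ m)⁻¹ * (u * q ^ m) = u := by rw [mul_comm u, inv_mul_cancel_left]
        rw [this]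
        exact ⟨hu1, hu2.trans hR.le⟩
    intro a ha
    rcases le_total ‖(a : F)‖ 1 with h | h
    · left
      obtain ⟨m, hm, h⟩ := key a h ha
      simp only [Set.mem_iUnion]
      exact ⟨m, hm, h⟩
    · right
      obtain ⟨m, hm, h1, h2⟩ := key a⁻¹ (by
        rw [Units.val_inv_eq_inv_val, norm_inv]; exact inv_le_one_of_one_le₀ h)
        (by rw [absMax_inv]; exact ha)
      simp only [Set.mem_iUnion]
      refine ⟨m, hm, ?_⟩
      rw [← mul_inv, Units.val_inv_eq_inv_val, norm_inv] at h1 h2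
      have hp := norm_unit_pos (q ^ m * a)
      exact ⟨(inv_le_inv₀ hp hq0).1 h2,
        (le_inv_comm₀ hq0 hp).1 h1⟩
  have hone : ∀ b : Fˣ, dt ((fun a => b * a) ⁻¹' S) = dt S := fun b => measure_preimage_mul dt b S
  have hsum : ∀ g : ℕ → Fˣ, dt (⋃ m ∈ Finset.range (n + 1), (fun a => g m * a) ⁻¹' S) ≤
      ((n + 1 : ℕ) : ℝ≥0∞) * dt S := by
    intro g
    refine (measure_biUnion_finset_le _ _).trans ?_
    simp [hone]
  refine (measure_mono hsub).trans ((measure_union_le _ _).trans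
    ((add_le_add (hsum _) (hsum _)).trans ?_))
  have hfin : dt S ≠ ∞ := hSc.measure_ne_top
  rw [ENNReal.ofReal_mul (by positivity), ENNReal.ofReal_mul (by norm_num),
    ENNReal.ofReal_toReal hfin, ENNReal.ofReal_pow (by norm_num), ← two_mul]
  have h2 : ENNReal.ofReal 2 = 2 := by norm_num
  rw [h2, ← mul_assoc, mul_right_comm]
  gcongr
  exact_mod_cast Nat.lt_two_pow_self

end LocalField

end ZetaTwo

namespace ZetaTwo

open Filter Topology ENNReal

section Convergence

variable {F : Type*} [NontriviallyNormedField F]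

/-! ### Polynomial decay conditions -/

/-- `W (diag(a, 1) k)` is rapidly decreasing as `‖a‖ → ∞` and has at most polynomial growth as
`a → 0`, uniformly for `k ∈ K`. -/
def HasTorusDecay (K : Subgroup (GL (Fin 2) F)) (W : GL (Fin 2) F → ℂ) : Prop :=
  ∃ B : ℕ, ∀ M : ℕ, ∃ C : ℝ, 0 ≤ C ∧ ∀ k ∈ K, ∀ a : Fˣ,
    (‖(a : F)‖ ≤ 1 → ‖W (diagOne a * k)‖ ≤ C * absMax a ^ B) ∧
    (1 ≤ ‖(a : F)‖ → ‖W (diagOne a * k)‖ * absMax a ^ M ≤ C)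

/-- The sum of the norms of the entries. -/
def entrySize (X : Matrix (Fin 2) (Fin 2) F) : ℝ := ∑ i, ∑ j, ‖X i j‖

/-- A function on pairs of matrices that decays faster than any power of the entries. -/
def IsRapidlyDecreasing
    (f : Matrix (Fin 2) (Fin 2) F × Matrix (Fin 2) (Fin 2) F → ℂ) : Prop :=
  ∀ P : ℕ, ∃ C : ℝ, ∀ X Y, ‖f (X, Y)‖ * (1 + entrySize X + entrySize Y) ^ P ≤ C

theorem entrySize_nonneg (X : Matrix (Fin 2) (Fin 2) F) : 0 ≤ entrySize X :=
  Finset.sum_nonneg fun _ _ => Finset.sum_nonneg fun _ _ => norm_nonneg _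

theorem entrySize_mul_le {k : Matrix (Fin 2) (Fin 2) F} (hk : ∀ i j, ‖k i j‖ ≤ 1)
    (X : Matrix (Fin 2) (Fin 2) F) : entrySize (k * X) ≤ 2 * entrySize X := by
  have h : ∀ i j, ‖(k * X) i j‖ ≤ ∑ l, ‖X l j‖ := fun i j => by
    rw [Matrix.mul_apply]
    refine (norm_sum_le _ _).trans (Finset.sum_le_sum fun l _ => ?_)
    rw [norm_mul]
    exact mul_le_of_le_one_left (norm_nonneg _) (hk i l)
  have h00 := h 0 0
  have h01 := h 0 1
  have h10 := h 1 0
  have h11 := h 1 1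
  simp only [entrySize, Fin.sum_univ_two] at *
  linarith

theorem entrySize_transpose (X : Matrix (Fin 2) (Fin 2) F) : entrySize Xᵀ = entrySize X :=
  Finset.sum_comm

theorem mul_entrySize_le {k : Matrix (Fin 2) (Fin 2) F} (hk : ∀ i j, ‖k i j‖ ≤ 1)
    (X : Matrix (Fin 2) (Fin 2) F) : entrySize (X * k) ≤ 2 * entrySize X := by
  rw [← entrySize_transpose (X * k), ← entrySize_transpose X, Matrix.transpose_mul]
  exact entrySize_mul_le (fun i j => hk j i) _

/-- Invariance of the entry size, up to a constant, under a group with bounded entries. -/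
theorem entrySize_le_of_bounded {K : Subgroup (GL (Fin 2) F)}
    (hK : ∀ k ∈ K, ∀ i j, ‖k.val i j‖ ≤ 1) {k₁ k₂ : GL (Fin 2) F} (h₁ : k₁ ∈ K) (h₂ : k₂ ∈ K)
    (X : Matrix (Fin 2) (Fin 2) F) :
    entrySize X ≤ 4 * entrySize ((k₁⁻¹ : GL (Fin 2) F).val * X * k₂.val) := by
  have h : X = k₁.val * (((k₁⁻¹ : GL (Fin 2) F).val * X * k₂.val) *
      (k₂⁻¹ : GL (Fin 2) F).val) := by
    simp only [← Matrix.mul_assoc, ← Units.val_mul, mul_inv_cancel, Units.val_one, Matrix.one_mul]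
    rw [Matrix.mul_assoc, ← Units.val_mul, mul_inv_cancel, Units.val_one, Matrix.mul_one]
  calc entrySize X = _ := congrArg entrySize h
    _ ≤ 2 * (2 * entrySize ((k₁⁻¹ : GL (Fin 2) F).val * X * k₂.val)) :=
      (entrySize_mul_le (hK _ h₁) _).trans
        (mul_le_mul_of_nonneg_left (mul_entrySize_le (hK _ (K.inv_mem h₂)) _) zero_le_two)
    _ = _ := by ring

variable [ProperSpace F]

theorem norm_quasiChar_le (χ : Fˣ →ₜ* ℂˣ) :
    ∃ (C : ℝ) (A : ℕ), 0 ≤ C ∧ ∀ a : Fˣ, ‖((χ a : ℂˣ) : ℂ)‖ ≤ C * absMax a ^ A := by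
  refine submultiplicative_le_absMax_pow (fun a => norm_nonneg _) (fun a b => by simp) ?_
  intro S hS
  obtain ⟨C, hC⟩ := (hS.image (Units.continuous_val.comp χ.continuous_toFun).norm).bddAbove
  exact ⟨C, fun a ha => hC ⟨a, ha, rfl⟩⟩

variable [MeasurableSpace F] [BorelSpace F]

theorem norm_absPow (a : Fˣ) (s : ℂ) : ‖absPow a s‖ = normAbs a ^ s.re :=
  Complex.norm_cpow_eq_rpow_re_of_pos (normAbs_pos a) s

theorem norm_absPow_le (s : ℂ) :
    ∃ (C : ℝ) (A : ℕ), 0 ≤ C ∧ ∀ a : Fˣ, ‖absPow a s‖ ≤ C * absMax a ^ A := by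
  simp only [norm_absPow]
  refine submultiplicative_le_absMax_pow (fun a => Real.rpow_nonneg (normAbs_pos a).le _)
    (fun a b => by rw [normAbs_mul, Real.mul_rpow (normAbs_pos a).le (normAbs_pos b).le]) ?_
  intro S hS
  obtain ⟨C, hC⟩ := (hS.image (continuous_normAbs.rpow_const
    fun a => Or.inl (normAbs_pos a).ne')).bddAbove
  exact ⟨C, fun a ha => hC ⟨a, ha, rfl⟩⟩

theorem continuous_absPow (s : ℂ) : Continuous fun a : Fˣ => absPow a s :=
  (Complex.continuous_ofReal.comp continuous_normAbs).cpow continuous_const fun a =>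
    Or.inl (normAbs_pos a)

/-- Uniform bound for the integrand on the torus. -/
theorem norm_torusIntegrand_le {K : Subgroup (GL (Fin 2) F)} {W : GL (Fin 2) F → ℂ}
    (hW : HasTorusDecay K W) (ψ : AddChar F Circle) (χ : Fˣ →ₜ* ℂˣ) (P : ℕ) :
    ∃ c : ℝ, ∀ s : ℂ, c < s.re → ∃ C : ℝ, 0 ≤ C ∧ ∀ k ∈ K, ∀ u a,
      ‖torusIntegrand ψ W χ s k u a‖ ≤ C * (absMax a)⁻¹ ^ P := by
  obtain ⟨B, hB⟩ := hW
  obtain ⟨Cχ, Aχ, hCχ, hχ⟩ := norm_quasiChar_le χ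
  obtain ⟨A, D, hD1, hD⟩ := exists_normAbs_pow_le (F := F)
  have hD0 : 0 ≤ D := zero_le_one.trans hD1
  -- Near 0 the factor |a|^(s-1/2) has to beat `absMax a ^ (B + Aχ + P)`. Each power of `absMax a`
  -- costs A powers of the module, and the remaining exponent σ ≥ 0 costs only a constant.
  refine ⟨(A * (B + Aχ + P) : ℕ) + 1 / 2, fun s hs => ?_⟩
  obtain ⟨Cs, As, hCs, hS⟩ := norm_absPow_le (F := F) (s - 1 / 2)
  -- At infinity the order of decay may depend on s through `As`. The growth exponent B was fixed
  -- earlier, so the threshold for the real part does not depend on s.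
  obtain ⟨C₁, hC₁, h₁⟩ := hB (Aχ + As + P)
  set Q := B + Aχ + P with hQ
  set σ : ℝ := (s - 1 / 2).re - (A * Q : ℕ) with hσ
  have hσ0 : 0 ≤ σ := by
    have h1 : (s - 1 / 2).re = s.re - 1 / 2 := by simp
    rw [hσ, h1]
    linarith
  refine ⟨C₁ * Cχ * Cs + C₁ * Cχ * (D ^ Q * D ^ σ), by positivity, fun k hk u a => ?_⟩
  have hnorm : ‖torusIntegrand ψ W χ s k u a‖ =
      ‖W (diagOne a * k)‖ * ‖((χ a : ℂˣ) : ℂ)‖ * ‖absPow a (s - 1 / 2)‖ := by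
    simp only [torusIntegrand, norm_mul, Circle.norm_coe, mul_one]
  have hm := absMax_pos a
  rw [hnorm, inv_pow, ← div_eq_mul_inv, le_div_iff₀ (pow_pos hm P)]
  rcases le_total ‖(a : F)‖ 1 with ha | ha
  · have hW1 := (h₁ k hk a).1 ha
    obtain ⟨hn1, hn2⟩ := hD a ha
    have hn0 := normAbs_pos a
    have habs : ‖absPow a (s - 1 / 2)‖ * absMax a ^ Q ≤ D ^ Q * D ^ σ := by
      rw [norm_absPow, show (s - 1 / 2).re = ((A * Q : ℕ) : ℝ) + σ by rw [hσ]; ring,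
        Real.rpow_add hn0, Real.rpow_natCast, pow_mul]
      have h2 : normAbs a ^ A * absMax a ≤ D := by
        rw [absMax_of_le_one ha, ← div_eq_mul_inv, div_le_iff₀ (norm_unit_pos a)]
        exact hn2
      calc (normAbs a ^ A) ^ Q * normAbs a ^ σ * absMax a ^ Q
          = (normAbs a ^ A * absMax a) ^ Q * normAbs a ^ σ := by ring
        _ ≤ D ^ Q * D ^ σ := by gcongr
    calc ‖W (diagOne a * k)‖ * ‖((χ a : ℂˣ) : ℂ)‖ * ‖absPow a (s - 1 / 2)‖ * absMax a ^ P
        ≤ (C₁ * absMax a ^ B) * (Cχ * absMax a ^ Aχ) * ‖absPow a (s - 1 / 2)‖ * absMax a ^ P := by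
          gcongr
          exact hχ a
      _ = C₁ * Cχ * (‖absPow a (s - 1 / 2)‖ * absMax a ^ Q) := by rw [hQ]; ring
      _ ≤ C₁ * Cχ * (D ^ Q * D ^ σ) := by gcongr
      _ ≤ _ := le_add_of_nonneg_left (by positivity)
  · have hW1 := (h₁ k hk a).2 ha
    calc ‖W (diagOne a * k)‖ * ‖((χ a : ℂˣ) : ℂ)‖ * ‖absPow a (s - 1 / 2)‖ * absMax a ^ P
        ≤ ‖W (diagOne a * k)‖ * (Cχ * absMax a ^ Aχ) * (Cs * absMax a ^ As) * absMax a ^ P := by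
          gcongr
          · exact hχ a
          · exact hS a
      _ = (‖W (diagOne a * k)‖ * absMax a ^ (Aχ + As + P)) * Cχ * Cs := by ring
      _ ≤ C₁ * Cχ * Cs := by gcongr
      _ ≤ _ := le_add_of_nonneg_right (by positivity)

/-- Decoupled bound for the Schwartz weight. -/
theorem norm_schwartzWeight_le {K : Subgroup (GL (Fin 2) F)}
    (hK : ∀ k ∈ K, ∀ i j, ‖k.val i j‖ ≤ 1)
    {f : Matrix (Fin 2) (Fin 2) F × Matrix (Fin 2) (Fin 2) F → ℂ} (hf : IsRapidlyDecreasing f)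
    (ω : Fˣ →ₜ* ℂˣ) (s : ℂ) (P P' : ℕ) :
    ∃ C : ℝ, 0 ≤ C ∧ ∀ u v ε, ∀ k₁ ∈ K, ∀ k₂ ∈ K, ‖schwartzWeight f ω s u v ε k₁ k₂‖ ≤
      C * ((1 + ‖u‖)⁻¹ ^ P * (1 + ‖v‖)⁻¹ ^ P * (absMax ε)⁻¹ ^ P') := by
  obtain ⟨Cω, Aω, hCω, hω⟩ := norm_quasiChar_le ω
  obtain ⟨Cs, As, hCs, hs⟩ := norm_absPow_le (F := F) (2 * s - 2)
  -- Below, N bounds `absMax ε` and N² bounds both 1 + ‖u‖ and 1 + ‖v‖. Hence 2P + 2P for u and v,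
  -- and Aω + As + P' for the character, the power of |ε| and the required decay in ε.
  set E := (2 * P + 2 * P) + (Aω + As + P') with hE
  obtain ⟨C, hC⟩ := hf E
  have hC0 : 0 ≤ C := (mul_nonneg (norm_nonneg _) (pow_nonneg (add_nonneg (add_nonneg zero_le_one
    (entrySize_nonneg 0)) (entrySize_nonneg 0)) _)).trans (hC 0 0)
  refine ⟨4 ^ E * C * Cω * Cs, by positivity, fun u v ε k₁ hk₁ k₂ hk₂ => ?_⟩
  set X : Matrix (Fin 2) (Fin 2) F := !![(ε : F)⁻¹, (ε : F)⁻¹ * v; 0, 0] with hX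
  set Y : Matrix (Fin 2) (Fin 2) F := !![0, -u * (ε : F); 0, (ε : F)] with hY
  set X' := (k₁⁻¹ : GL (Fin 2) F).val * X * k₂.val
  set Y' := (k₁⁻¹ : GL (Fin 2) F).val * Y * k₂.val
  have hsX : entrySize X = ‖(ε : F)‖⁻¹ + ‖(ε : F)‖⁻¹ * ‖v‖ := by
    simp [entrySize, hX, Fin.sum_univ_two]
  have hsY : entrySize Y = ‖u‖ * ‖(ε : F)‖ + ‖(ε : F)‖ := by
    simp [entrySize, hY, Fin.sum_univ_two]
  set N := 1 + entrySize X + entrySize Y with hN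
  have he := norm_unit_pos ε
  have hei := inv_pos.2 he
  have hmul : ‖(ε : F)‖ * ‖(ε : F)‖⁻¹ = 1 := mul_inv_cancel₀ he.ne'
  have hNX := entrySize_nonneg X
  have hNY := entrySize_nonneg Y
  have hX' := entrySize_nonneg X'
  have hY' := entrySize_nonneg Y'
  have hN1 : 1 ≤ N := by linarith
  have hu0 := norm_nonneg u
  have hv0 := norm_nonneg v
  -- The entry uε alone does not bound u; it is multiplied by the entry ε⁻¹ of the other matrix.
  have hu : 1 + ‖u‖ ≤ N ^ 2 := by
    calc 1 + ‖u‖ = 1 + ‖u‖ * (‖(ε : F)‖ * ‖(ε : F)‖⁻¹) := by rw [hmul, mul_one]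
      _ ≤ (1 + ‖u‖ * ‖(ε : F)‖) * (1 + ‖(ε : F)‖⁻¹) := by nlinarith [mul_nonneg hu0 he.le]
      _ ≤ N * N := by
        have h1 := mul_nonneg hei.le hv0
        have h2 := mul_nonneg hu0 he.le
        gcongr <;> rw [hN, hsX, hsY] <;> linarith
      _ = N ^ 2 := by ring
  have hv : 1 + ‖v‖ ≤ N ^ 2 := by
    calc 1 + ‖v‖ = 1 + (‖(ε : F)‖ * ‖(ε : F)‖⁻¹) * ‖v‖ := by rw [hmul, one_mul]
      _ ≤ (1 + ‖(ε : F)‖) * (1 + ‖(ε : F)‖⁻¹ * ‖v‖) := by nlinarith [mul_nonneg hei.le hv0]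
      _ ≤ N * N := by
        have h1 := mul_nonneg hei.le hv0
        have h2 := mul_nonneg hu0 he.le
        gcongr <;> rw [hN, hsX, hsY] <;> linarith
      _ = N ^ 2 := by ring
  have hm : absMax ε ≤ N := by
    have h1 := mul_nonneg hei.le hv0
    have h2 := mul_nonneg hu0 he.le
    refine max_le ?_ ?_ <;> rw [hN, hsX, hsY] <;> linarith
  have hN4 : N ≤ 4 * (1 + entrySize X' + entrySize Y') := by
    have h1 := entrySize_le_of_bounded hK hk₁ hk₂ X
    have h2 := entrySize_le_of_bounded hK hk₁ hk₂ Y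
    simp only [hN]
    linarith
  have hm0 := absMax_pos ε
  have hnorm : ‖schwartzWeight f ω s u v ε k₁ k₂‖ =
      ‖f (X', Y')‖ * ‖((ω ε : ℂˣ) : ℂ)‖ * ‖absPow ε (2 * s - 2)‖ := by
    simp only [schwartzWeight, norm_mul]
    rfl
  have hden : (1 + ‖u‖)⁻¹ ^ P * (1 + ‖v‖)⁻¹ ^ P * (absMax ε)⁻¹ ^ P' =
      ((1 + ‖u‖) ^ P * (1 + ‖v‖) ^ P * absMax ε ^ P')⁻¹ := by
    simp only [inv_pow, mul_inv]
  rw [hnorm, hden, ← div_eq_mul_inv, le_div_iff₀ (by positivity)]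
  calc ‖f (X', Y')‖ * ‖((ω ε : ℂˣ) : ℂ)‖ * ‖absPow ε (2 * s - 2)‖ *
        ((1 + ‖u‖) ^ P * (1 + ‖v‖) ^ P * absMax ε ^ P')
      ≤ ‖f (X', Y')‖ * (Cω * N ^ Aω) * (Cs * N ^ As) *
        ((N ^ 2) ^ P * (N ^ 2) ^ P * N ^ P') := by
        gcongr
        · exact (hω ε).trans (by gcongr)
        · exact (hs ε).trans (by gcongr)
    _ = ‖f (X', Y')‖ * N ^ E * Cω * Cs := by
        rw [hE]
        generalize N = n
        ring
    _ ≤ ‖f (X', Y')‖ * (4 * (1 + entrySize X' + entrySize Y')) ^ E * Cω * Cs := by gcongr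
    _ = 4 ^ E * (‖f (X', Y')‖ * (1 + entrySize X' + entrySize Y') ^ E) * Cω * Cs := by
        rw [mul_pow]
        generalize (1 + entrySize X' + entrySize Y') ^ E = t, (4 : ℝ) ^ E = r
        ring
    _ ≤ 4 ^ E * C * Cω * Cs := by gcongr; exact hC X' Y'

end Convergence

end ZetaTwo

namespace ZetaTwo

open Filter Topology ENNReal

/-! ### Continuity of the integrands and domination -/

section Convergence

variable {F : Type*} [NontriviallyNormedField F] [ProperSpace F]

/-- Second countability identifies the Borel and product σ-algebras on the product domains, so that
continuous integrands are measurable there. -/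
instance secondCountableTopology_GL : SecondCountableTopology (GL (Fin 2) F) := by
  have h1 : SecondCountableTopology (Matrix (Fin 2) (Fin 2) F) :=
    inferInstanceAs (SecondCountableTopology (Fin 2 → Fin 2 → F))
  have h2 : SecondCountableTopology (Matrix (Fin 2) (Fin 2) F)ᵐᵒᵖ :=
    MulOpposite.opHomeomorph.symm.secondCountableTopology
  exact Units.isEmbedding_embedProduct.secondCountableTopology

instance secondCountableTopology_subgroup (K : Subgroup (GL (Fin 2) F)) :
    SecondCountableTopology K :=
  Topology.IsEmbedding.subtypeVal.secondCountableTopology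

variable [MeasurableSpace F] [BorelSpace F]

theorem continuous_torusIntegrand {ψ : AddChar F Circle} (hψ : Continuous ψ)
    {W : GL (Fin 2) F → ℂ} (hW : Continuous W) (χ : Fˣ →ₜ* ℂˣ) (s : ℂ) :
    Continuous fun p : GL (Fin 2) F × F × Fˣ => torusIntegrand ψ W χ s p.1 p.2.1 p.2.2 := by
  unfold torusIntegrand
  refine Continuous.mul (Continuous.mul (Continuous.mul ?_ ?_) ?_) ?_
  · exact hW.comp ((continuous_diagOne.comp continuous_snd.snd).mul continuous_fst)
  · exact continuous_subtype_val.comp (hψ.comp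
      (continuous_snd.fst.mul (Units.continuous_val.comp continuous_snd.snd)))
  · exact Units.continuous_val.comp (χ.continuous_toFun.comp continuous_snd.snd)
  · exact (continuous_absPow _).comp continuous_snd.snd

theorem continuous_schwartzWeight
    {f : Matrix (Fin 2) (Fin 2) F × Matrix (Fin 2) (Fin 2) F → ℂ} (hf : Continuous f)
    (ω : Fˣ →ₜ* ℂˣ) (s : ℂ) :
    Continuous fun p : F × F × Fˣ × GL (Fin 2) F × GL (Fin 2) F =>
      schwartzWeight f ω s p.1 p.2.1 p.2.2.1 p.2.2.2.1 p.2.2.2.2 := by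
  unfold schwartzWeight
  have hε : Continuous fun p : F × F × Fˣ × GL (Fin 2) F × GL (Fin 2) F => (p.2.2.1 : F) :=
    Units.continuous_val.comp continuous_snd.snd.fst
  have hεi : Continuous fun p : F × F × Fˣ × GL (Fin 2) F × GL (Fin 2) F => (p.2.2.1 : F)⁻¹ :=
    hε.inv₀ fun p => p.2.2.1.ne_zero
  have hv : Continuous fun p : F × F × Fˣ × GL (Fin 2) F × GL (Fin 2) F => p.2.1 :=
    continuous_snd.fst
  refine Continuous.mul (Continuous.mul ?_ ?_) ?_
  · have h1 : Continuous fun p : F × F × Fˣ × GL (Fin 2) F × GL (Fin 2) F =>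
        (p.2.2.2.1⁻¹ : GL (Fin 2) F).val :=
      Units.continuous_val.comp (continuous_inv.comp continuous_snd.snd.snd.fst)
    have h2 : Continuous fun p : F × F × Fˣ × GL (Fin 2) F × GL (Fin 2) F =>
        (p.2.2.2.2 : GL (Fin 2) F).val :=
      Units.continuous_val.comp continuous_snd.snd.snd.snd
    refine hf.comp (Continuous.prodMk ((h1.matrix_mul (continuous_matrix ?_)).matrix_mul h2)
      ((h1.matrix_mul (continuous_matrix ?_)).matrix_mul h2)) <;>
    · intro i j
      fin_cases i <;> fin_cases j <;> simp <;> fun_prop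
  · exact Units.continuous_val.comp (ω.continuous_toFun.comp continuous_snd.snd.fst)
  · exact (continuous_absPow _).comp continuous_snd.snd.fst

variable {K : Subgroup (GL (Fin 2) F)}

theorem continuous_fullIntegrand {ψ : AddChar F Circle} (hψ : Continuous ψ)
    {W₁ W₂ : GL (Fin 2) F → ℂ} (hW₁ : Continuous W₁) (hW₂ : Continuous W₂)
    {f : Matrix (Fin 2) (Fin 2) F × Matrix (Fin 2) (Fin 2) F → ℂ} (hf : Continuous f)
    (ω μ : Fˣ →ₜ* ℂˣ) (s₁ s₂ : ℂ) :
    Continuous (fullIntegrand (K := K) ψ ω μ W₁ W₂ f s₁ s₂) := by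
  unfold fullIntegrand
  have hk₁ : Continuous fun q : (F × F × Fˣ × K × K) × (Fˣ × Fˣ) =>
      (q.1.2.2.2.1 : GL (Fin 2) F) :=
    continuous_subtype_val.comp continuous_fst.snd.snd.snd.fst
  have hk₂ : Continuous fun q : (F × F × Fˣ × K × K) × (Fˣ × Fˣ) =>
      (q.1.2.2.2.2 : GL (Fin 2) F) :=
    continuous_subtype_val.comp continuous_fst.snd.snd.snd.snd
  refine Continuous.mul (Continuous.mul ?_ ?_) ?_
  · have h := (continuous_schwartzWeight hf ω s₂).comp (continuous_fst.fst.prodMk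
      (continuous_fst.snd.fst.prodMk (continuous_fst.snd.snd.fst.prodMk (hk₁.prodMk hk₂))))
    simpa only [Function.comp_def] using h
  · have h := (continuous_torusIntegrand hψ hW₁ μ s₁).comp (hk₁.prodMk
      (continuous_fst.fst.prodMk continuous_snd.fst))
    simpa only [Function.comp_def] using h
  · have h := (continuous_torusIntegrand hψ hW₂ μ⁻¹ s₂).comp (hk₂.prodMk
      (continuous_fst.snd.fst.prodMk continuous_snd.snd))
    simpa only [Function.comp_def] using h

/-- Absolute convergence of the zeta integral for functions `W₁`, `W₂` with polynomial growth at
`0` and rapid decay at infinity along the torus. -/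
theorem zetaConvergesAbsolutely_of_hasTorusDecay [CompactSpace K]
    (hK : ∀ k ∈ K, ∀ i j, ‖k.val i j‖ ≤ 1) [MeasurableSpace K] [BorelSpace K]
    (dx : Measure F) [dx.IsAddHaarMeasure] (dt : Measure Fˣ) [dt.IsHaarMeasure]
    (dk : Measure K) [dk.IsHaarMeasure] {ψ : AddChar F Circle} (hψ : Continuous ψ)
    (ω μ : Fˣ →ₜ* ℂˣ) {W₁ W₂ : GL (Fin 2) F → ℂ} (hc₁ : Continuous W₁) (hc₂ : Continuous W₂)
    (hW₁ : HasTorusDecay K W₁) (hW₂ : HasTorusDecay K W₂) :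
    ∃ c : ℝ, ∀ f, Continuous f → IsRapidlyDecreasing f →
      ∀ s₁ s₂ : ℂ, c < s₁.re → c < s₂.re →
        ZetaConvergesAbsolutely dx dt dk ψ ω μ W₁ W₂ f s₁ s₂ := by
  obtain ⟨P, hP⟩ := exists_integrable_one_add_norm dx
  obtain ⟨P', hP'⟩ := exists_integrable_absMax dt
  obtain ⟨c₁, h₁⟩ := norm_torusIntegrand_le hW₁ ψ μ P'
  obtain ⟨c₂, h₂⟩ := norm_torusIntegrand_le hW₂ ψ μ⁻¹ P'
  refine ⟨max c₁ c₂, fun f hf hfd s₁ s₂ hs₁ hs₂ => ?_⟩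
  obtain ⟨C₁, hC₁, h₁⟩ := h₁ s₁ ((le_max_left _ _).trans_lt hs₁)
  obtain ⟨C₂, hC₂, h₂⟩ := h₂ s₂ ((le_max_right _ _).trans_lt hs₂)
  obtain ⟨C, hC, h⟩ := norm_schwartzWeight_le hK hfd ω s₂ P P'
  have hfull : Integrable (fullIntegrand ψ ω μ W₁ W₂ f s₁ s₂)
      ((outerMeasure dx dt dk).prod (dt.prod dt)) := by
    have hdom : Integrable (fun q : (F × F × Fˣ × K × K) × (Fˣ × Fˣ) =>
        (C * C₁ * C₂) * (((1 + ‖q.1.1‖)⁻¹ ^ P * ((1 + ‖q.1.2.1‖)⁻¹ ^ P *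
          ((absMax q.1.2.2.1)⁻¹ ^ P' * ((1 : ℝ) * 1)))) *
          ((absMax q.2.1)⁻¹ ^ P' * (absMax q.2.2)⁻¹ ^ P')))
        ((outerMeasure dx dt dk).prod (dt.prod dt)) := by
      refine Integrable.const_mul ?_ _
      have hone : Integrable (fun _ : K => (1 : ℝ)) dk := integrable_const 1
      exact (hP.mul_prod (hP.mul_prod (hP'.mul_prod (hone.mul_prod hone)))).mul_prod
        (hP'.mul_prod hP')
    refine hdom.mono' (continuous_fullIntegrand hψ hc₁ hc₂ hf ω μ s₁ s₂).aestronglyMeasurable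
      (ae_of_all _ ?_)
    rintro ⟨⟨u, v, ε, k₁, k₂⟩, α, β⟩
    have e0 := h u v ε k₁ k₁.2 k₂ k₂.2
    have e1 := h₁ k₁ k₁.2 u α
    have e2 := h₂ k₂ k₂.2 v β
    have hu := norm_nonneg u
    have hv := norm_nonneg v
    have hmε := absMax_pos ε
    have hmα := absMax_pos α
    have hmβ := absMax_pos β
    simp only [fullIntegrand, norm_mul]
    calc _ ≤ (C * ((1 + ‖u‖)⁻¹ ^ P * (1 + ‖v‖)⁻¹ ^ P * (absMax ε)⁻¹ ^ P')) *
          (C₁ * (absMax α)⁻¹ ^ P') * (C₂ * (absMax β)⁻¹ ^ P') := by gcongr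
      _ = _ := by ring
  have hinner : ∀ (W : GL (Fin 2) F → ℂ) (χ : Fˣ →ₜ* ℂˣ) (s : ℂ) (C : ℝ), Continuous W →
      (∀ k ∈ K, ∀ u a, ‖torusIntegrand ψ W χ s k u a‖ ≤ C * (absMax a)⁻¹ ^ P') →
      ∀ (k : K) (u : F), Integrable (torusIntegrand ψ W χ s k u) dt := by
    intro W χ s C hW hb k u
    refine (hP'.const_mul C).mono' (Continuous.aestronglyMeasurable ?_)
      (ae_of_all _ fun a => hb k k.2 u a)
    have h := (continuous_torusIntegrand hψ hW χ s).comp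
      ((continuous_const (y := (k : GL (Fin 2) F))).prodMk
        ((continuous_const (y := u)).prodMk (continuous_id (X := Fˣ))))
    simpa only [Function.comp_def, id] using h
  refine ⟨hinner W₁ μ s₁ C₁ hc₁ h₁, hinner W₂ μ⁻¹ s₂ C₂ hc₂ h₂, ?_, hfull⟩
  -- For fixed (u, v, ε, k₁, k₂) the integral over (α, β) factors, so integrating the full integrand
  -- over (α, β) yields the outer one.
  refine hfull.integral_prod_left.congr (ae_of_all _ fun p => ?_)
  simp only [fullIntegrand, outerIntegrand, mul_assoc]
  rw [integral_const_mul, integral_prod_mul]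

end Convergence

end ZetaTwo

namespace ZetaTwo

open Filter Topology

/-! ### Compact subsets of GL₂ and conjugation by the torus -/

section Compactness

variable {F : Type*} [NontriviallyNormedField F]

theorem unip_neg_eq_inv (x : F) : (unip x)⁻¹ = unip (-x) := by
  rw [inv_eq_iff_mul_eq_one]
  ext i j
  fin_cases i <;> fin_cases j <;> simp [unip, GeneralLinearGroup.upperRightHom, Matrix.mul_apply]

theorem conj_diagOne_apply (a : Fˣ) (g : GL (Fin 2) F) :
    ((diagOne a)⁻¹ * g * diagOne a).val =
      !![g.val 0 0, (a : F)⁻¹ * g.val 0 1; (a : F) * g.val 1 0, g.val 1 1] := by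
  have : ((diagOne a)⁻¹ : GL (Fin 2) F).val = !![((a⁻¹ : Fˣ) : F), 0; 0, 1] := rfl
  rw [Units.val_mul, Units.val_mul, this]
  ext i j
  simp only [Matrix.mul_apply, Fin.sum_univ_two]
  fin_cases i <;> fin_cases j <;> simp [diagOne, mul_comm]

variable [ProperSpace F]

/-- By g ↦ (g, g⁻¹) the group is a closed subset of a product of two matrix spaces, where bounded
closed sets are compact. Hence the bounds on both g and g⁻¹. -/
theorem isCompact_bounded_GL (B : ℝ) :
    IsCompact {g : GL (Fin 2) F | (∀ i j, ‖g.val i j‖ ≤ B) ∧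
      ∀ i j, ‖(g⁻¹ : GL (Fin 2) F).val i j‖ ≤ B} := by
  have hB : IsCompact {X : Matrix (Fin 2) (Fin 2) F | ∀ i j, ‖X i j‖ ≤ B} := by
    have h : IsCompact (Set.univ.pi fun _ : Fin 2 => Set.univ.pi fun _ : Fin 2 =>
        Metric.closedBall (0 : F) B) :=
      isCompact_univ_pi fun _ => isCompact_univ_pi fun _ => isCompact_closedBall 0 B
    have hset : {X : Fin 2 → Fin 2 → F | ∀ i j, ‖X i j‖ ≤ B} =
        Set.univ.pi fun _ : Fin 2 => Set.univ.pi fun _ : Fin 2 => Metric.closedBall (0 : F) B := by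
      ext X
      simp only [Set.mem_ofPred_eq, Set.mem_univ_pi, mem_closedBall_zero_iff]
    rw [← hset] at h
    exact h
  exact Units.isClosedEmbedding_embedProduct.isCompact_preimage (hB.prod (hB.image MulOpposite.continuous_op)) |>.of_isClosed_subset
    (by
      have h1 : ∀ i j, Continuous fun g : GL (Fin 2) F => ‖g.val i j‖ := fun i j =>
        (Units.continuous_val.matrix_elem i j).norm
      have h2 : ∀ i j, Continuous fun g : GL (Fin 2) F => ‖(g⁻¹ : GL (Fin 2) F).val i j‖ :=
        fun i j => (h1 i j).comp continuous_inv
      simp only [Set.ofPred_and, Set.ofPred_forall]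
      exact (isClosed_iInter fun i => isClosed_iInter fun j =>
        isClosed_le (h1 i j) continuous_const).inter
        (isClosed_iInter fun i => isClosed_iInter fun j => isClosed_le (h2 i j) continuous_const))
    fun g hg => ⟨hg.1, _, hg.2, rfl⟩

end Compactness

section Ultrametric

variable {F : Type*} [NontriviallyNormedField F] [IsUltrametricDist F]

/-! ### Congruence subgroups -/

/-- The principal congruence subgroup of radius `r` in `GL₂(𝒪)`. -/
def congruenceGL (r : ℝ) (hr0 : 0 < r) (hr1 : r ≤ 1) : Subgroup (GL (Fin 2) F) where
  carrier := {g | (∀ i j, ‖(g.val - 1) i j‖ ≤ r) ∧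
    ∀ i j, ‖((g⁻¹ : GL (Fin 2) F).val - 1) i j‖ ≤ r}
  one_mem' := by simp [hr0.le]
  mul_mem' := by
    have key : ∀ A B : Matrix (Fin 2) (Fin 2) F, (∀ i j, ‖(A - 1) i j‖ ≤ r) →
        (∀ i j, ‖(B - 1) i j‖ ≤ r) → ∀ i j, ‖(A * B - 1) i j‖ ≤ r := by
      intro A B hA hB i j
      have h : A * B - 1 = (A - 1) * (B - 1) + (A - 1) + (B - 1) := by noncomm_ring
      have h3 : ‖((A - 1) * (B - 1)) i j‖ ≤ r := by
        rw [Matrix.mul_apply, Fin.sum_univ_two]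
        refine (IsUltrametricDist.norm_add_le_max _ _).trans (max_le ?_ ?_) <;>
        · rw [norm_mul]
          exact (mul_le_of_le_one_right (norm_nonneg _) ((hB _ _).trans hr1)).trans (hA _ _)
      rw [h, Matrix.add_apply, Matrix.add_apply]
      exact (IsUltrametricDist.norm_add_le_max _ _).trans (max_le
        ((IsUltrametricDist.norm_add_le_max _ _).trans (max_le h3 (hA i j))) (hB i j))
    rintro a b ⟨ha, ha'⟩ ⟨hb, hb'⟩
    refine ⟨?_, ?_⟩
    · rw [Units.val_mul]; exact key _ _ ha hb
    · rw [_root_.mul_inv_rev, Units.val_mul]; exact key _ _ hb' ha'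
  inv_mem' := by
    rintro a ⟨ha, ha'⟩
    exact ⟨ha', by rw [inv_inv]; exact ha⟩

theorem exists_congruenceGL_subset {U : Set (GL (Fin 2) F)} (hU : U ∈ 𝓝 1) :
    ∃ (r : ℝ) (hr0 : 0 < r) (hr1 : r < 1), (congruenceGL (F := F) r hr0 hr1.le : Set _) ⊆ U := by
  rw [Units.isEmbedding_embedProduct.nhds_eq_comap, mem_comap] at hU
  obtain ⟨T, hT, hTU⟩ := hU
  obtain ⟨A, hA, B, hB, hAB⟩ := mem_nhds_prod_iff.1 hT
  have hB' : MulOpposite.op ⁻¹' B ∈ 𝓝 (1 : Matrix (Fin 2) (Fin 2) F) :=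
    MulOpposite.continuous_op.continuousAt.preimage_mem_nhds hB
  have hA' : A ∩ MulOpposite.op ⁻¹' B ∈ 𝓝 (1 : Matrix (Fin 2) (Fin 2) F) := inter_mem hA hB'
  obtain ⟨s, hs, hsA⟩ := (Metric.nhds_basis_closedBall
    (x := fun i j => (1 : Matrix (Fin 2) (Fin 2) F) i j)).mem_iff.1 hA'
  have hmem : ∀ X : Matrix (Fin 2) (Fin 2) F, (∀ i j, ‖(X - 1) i j‖ ≤ s) →
      X ∈ A ∩ MulOpposite.op ⁻¹' B := by
    intro X hX
    refine hsA ?_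
    refine Metric.mem_closedBall.2 ((dist_pi_le_iff hs.le).2 fun i =>
      (dist_pi_le_iff hs.le).2 fun j => ?_)
    rw [dist_eq_norm]
    exact hX i j
  -- The cap 1/2 makes the radius strictly less than 1, which forces diagonal entries of norm 1 in
  -- the decomposition below.
  refine ⟨min s (1 / 2), by positivity, (min_le_right _ _).trans_lt (by norm_num), ?_⟩
  rintro g ⟨hg, hg'⟩
  refine hTU (hAB ⟨(hmem g.val fun i j => (hg i j).trans (min_le_left _ _)).1, ?_⟩)
  exact (hmem (g⁻¹ : GL (Fin 2) F).val fun i j => (hg' i j).trans (min_le_left _ _)).2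

theorem isOpen_congruenceGL {r : ℝ} (hr0 : 0 < r) (hr1 : r ≤ 1) :
    IsOpen (congruenceGL (F := F) r hr0 hr1 : Set (GL (Fin 2) F)) := by
  refine Subgroup.isOpen_of_mem_nhds (g := 1) _ ?_
  have h1 : ∀ i j, ∀ᶠ g : GL (Fin 2) F in 𝓝 1, ‖(g.val - 1) i j‖ ≤ r := by
    intro i j
    have hc : Continuous fun g : GL (Fin 2) F => ‖(g.val - 1) i j‖ :=
      ((Units.continuous_val.sub continuous_const).matrix_elem i j).norm
    refine (hc.tendsto 1).eventually (Filter.Eventually.mono (gt_mem_nhds ?_) fun _ h => h.le)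
    simpa using hr0
  have h2 : ∀ i j, ∀ᶠ g : GL (Fin 2) F in 𝓝 1, ‖((g⁻¹ : GL (Fin 2) F).val - 1) i j‖ ≤ r := by
    intro i j
    have : Tendsto (fun g : GL (Fin 2) F => g⁻¹) (𝓝 1) (𝓝 1) := by
      simpa using (continuous_inv (G := GL (Fin 2) F)).tendsto 1
    exact this.eventually (h1 i j)
  have := (eventually_all.2 fun i => eventually_all.2 (h1 i)).and
    (eventually_all.2 fun i => eventually_all.2 (h2 i))
  exact this

theorem congruenceGL_le_integralGL {r : ℝ} (hr0 : 0 < r) (hr1 : r ≤ 1) :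
    congruenceGL (F := F) r hr0 hr1 ≤ integralGL F := by
  have key : ∀ A : Matrix (Fin 2) (Fin 2) F, (∀ i j, ‖(A - 1) i j‖ ≤ r) → ∀ i j, ‖A i j‖ ≤ 1 := by
    intro A hA i j
    have h : A i j = (A - 1) i j + (1 : Matrix (Fin 2) (Fin 2) F) i j := by simp
    rw [h]
    refine (IsUltrametricDist.norm_add_le_max _ _).trans (max_le ((hA i j).trans hr1) ?_)
    rw [Matrix.one_apply]
    split_ifs <;> simp
  rintro g ⟨hg, hg'⟩
  exact ⟨key _ hg, key _ hg'⟩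

theorem unip_mem_congruenceGL {r : ℝ} (hr0 : 0 < r) (hr1 : r ≤ 1) {x : F} (hx : ‖x‖ ≤ r) :
    unip x ∈ congruenceGL (F := F) r hr0 hr1 := by
  have key : ∀ y : F, ‖y‖ ≤ r → ∀ i j, ‖((unip y).val - 1) i j‖ ≤ r := by
    intro y hy i j
    fin_cases i <;> fin_cases j <;> simp [unip, GeneralLinearGroup.upperRightHom, hr0.le, hy]
  exact ⟨key x hx, by rw [unip_neg_eq_inv]; exact key _ (by rwa [norm_neg])⟩

/-- Iwahori-type decomposition: an element of the congruence subgroup is an upper unipotent element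
times an element that stays in the congruence subgroup after conjugation by contracting
elements of the torus. -/
theorem congruenceGL_decomposition {r : ℝ} (hr0 : 0 < r) (hr1 : r < 1) {g : GL (Fin 2) F}
    (hg : g ∈ congruenceGL (F := F) r hr0 hr1.le) :
    ∃ (x : F) (g' : GL (Fin 2) F), ‖x‖ ≤ r ∧ g = unip x * g' ∧
      ∀ a : Fˣ, ‖(a : F)‖ ≤ 1 →
        (diagOne a)⁻¹ * g' * diagOne a ∈ congruenceGL (F := F) r hr0 hr1.le := by
  have hunit : ∀ y : F, ‖y - 1‖ ≤ r → ‖y‖ = 1 := by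
    intro y hy
    have h := IsUltrametricDist.norm_add_eq_max_of_norm_ne_norm (x := y - 1) (y := 1)
      (by rw [norm_one]; exact (hy.trans_lt hr1).ne)
    rw [sub_add_cancel, norm_one, max_eq_right (hy.trans hr1.le)] at h
    exact h
  have hd : ‖g.val 1 1‖ = 1 := hunit _ (by simpa using hg.1 1 1)
  have hd0 : g.val 1 1 ≠ 0 := norm_pos_iff.1 (by rw [hd]; exact one_pos)
  have hb : ‖g.val 0 1‖ ≤ r := by simpa using hg.1 0 1
  -- The entry d has norm 1, so n(-b/d) on the left clears the upper right entry without leaving the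
  -- subgroup. What remains is lower triangular, and conjugation only multiplies its lower left
  -- entry by a.
  set x : F := g.val 0 1 / g.val 1 1 with hx
  have hxr : ‖x‖ ≤ r := by rw [hx, norm_div, hd, div_one]; exact hb
  set g' : GL (Fin 2) F := (unip x)⁻¹ * g with hg'
  have hmem : g' ∈ congruenceGL (F := F) r hr0 hr1.le :=
    mul_mem (inv_mem (unip_mem_congruenceGL hr0 hr1.le hxr)) hg
  have h01 : g'.val 0 1 = 0 := by
    rw [hg', unip_neg_eq_inv, Units.val_mul, Matrix.mul_apply, Fin.sum_univ_two]
    simp [unip, GeneralLinearGroup.upperRightHom, hx, hd0]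
  have h00 : g'.val 0 0 ≠ 0 := norm_pos_iff.1 (by
    rw [hunit _ (by simpa using hmem.1 0 0)]; exact one_pos)
  have hi01 : (g'⁻¹ : GL (Fin 2) F).val 0 1 = 0 := by
    have h := congrFun (congrFun (g'.mul_inv) 0) 1
    rw [Matrix.mul_apply, Fin.sum_univ_two] at h
    simp only [h01, zero_mul, add_zero, Matrix.one_apply, if_false,
      Fin.isValue, zero_ne_one, mul_eq_zero, h00, false_or] at h
    exact h
  have key : ∀ (h : GL (Fin 2) F), (∀ i j, ‖(h.val - 1) i j‖ ≤ r) → h.val 0 1 = 0 →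
      ∀ a : Fˣ, ‖(a : F)‖ ≤ 1 →
        ∀ i j, ‖(((diagOne a)⁻¹ * h * diagOne a).val - 1) i j‖ ≤ r := by
    intro h hh h0 a ha i j
    rw [conj_diagOne_apply, h0]
    have e00 := hh 0 0
    have e10 := hh 1 0
    have e11 := hh 1 1
    fin_cases i <;> fin_cases j <;> simp at e00 e10 e11 ⊢
    · exact e00
    · exact hr0.le
    · exact (mul_le_of_le_one_left (norm_nonneg _) ha).trans e10
    · exact e11
  refine ⟨x, g', hxr, by rw [hg', mul_inv_cancel_left], fun a ha => ⟨key _ hmem.1 h01 a ha, ?_⟩⟩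
  have hinv : ((diagOne a)⁻¹ * g' * diagOne a)⁻¹ = (diagOne a)⁻¹ * g'⁻¹ * diagOne a := by
    group
  rw [hinv]
  exact key _ hmem.2 hi01 a ha

variable [ProperSpace F]

instance compactSpace_integralGL : CompactSpace (integralGL F) :=
  isCompact_iff_compactSpace.1 (isCompact_bounded_GL 1)

theorem isCompact_congruenceGL {r : ℝ} (hr0 : 0 < r) (hr1 : r ≤ 1) :
    IsCompact (congruenceGL (F := F) r hr0 hr1 : Set (GL (Fin 2) F)) :=
  (isCompact_bounded_GL 1).of_isClosed_subset
    (Subgroup.isClosed_of_isOpen _ (isOpen_congruenceGL hr0 hr1))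
    (congruenceGL_le_integralGL hr0 hr1)

/-- A continuous character of `F` is trivial near `0`. -/
theorem exists_addChar_trivial {F : Type*} [NontriviallyNormedField F] [IsUltrametricDist F]
    {ψ : AddChar F Circle} (hψ : Continuous ψ) :
    ∃ δ > 0, ∀ x : F, ‖x‖ ≤ δ → ψ x = 1 := by
  have hc : Continuous fun x : F => ‖((ψ x : Circle) : ℂ) - 1‖ :=
    ((continuous_subtype_val.comp hψ).sub continuous_const).norm
  have hev : ∀ᶠ x : F in 𝓝 0, ‖((ψ x : Circle) : ℂ) - 1‖ < 1 / 2 :=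
    (hc.tendsto 0).eventually (gt_mem_nhds (by simp))
  obtain ⟨δ, hδ, h⟩ := Metric.nhds_basis_closedBall.mem_iff.1 hev
  refine ⟨δ, hδ, fun x hx => ?_⟩
  -- The circle has no small subgroups. Since ‖2‖ ≤ 1, doubling x stays in the ball, whereas it
  -- squares ψ(x) and expands the distance to 1 by at least 3/2 as long as that distance is below
  -- 1/2.
  have hsmall : ∀ n : ℕ, ‖((ψ ((2 : F) ^ n * x) : Circle) : ℂ) - 1‖ < 1 / 2 := by
    intro n
    refine h ?_
    rw [mem_closedBall_zero_iff, norm_mul, norm_pow]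
    have h2 : ‖(2 : F)‖ ≤ 1 := by exact_mod_cast IsUltrametricDist.norm_natCast_le_one F 2
    exact (mul_le_of_le_one_left (norm_nonneg _) (pow_le_one₀ (norm_nonneg _) h2)).trans hx
  have hgrow : ∀ n : ℕ, (3 / 2 : ℝ) ^ n * ‖((ψ x : Circle) : ℂ) - 1‖ ≤
      ‖((ψ ((2 : F) ^ n * x) : Circle) : ℂ) - 1‖ := by
    intro n
    induction n with
    | zero => simp
    | succ n ih =>
      set z : ℂ := ((ψ ((2 : F) ^ n * x) : Circle) : ℂ) with hz
      have hsq : ((ψ ((2 : F) ^ (n + 1) * x) : Circle) : ℂ) = z * z := by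
        rw [show (2 : F) ^ (n + 1) * x = 2 ^ n * x + 2 ^ n * x by ring, AddChar.map_add_eq_mul,
          Circle.coe_mul]
      have h1 : z * z - 1 = (z - 1) * (z + 1) := by ring
      have h2 : (3 / 2 : ℝ) ≤ ‖z + 1‖ := by
        have h3 : ‖(2 : ℂ)‖ ≤ ‖z + 1‖ + ‖z - 1‖ := by
          have := norm_sub_le (z + 1) (z - 1)
          rwa [show z + 1 - (z - 1) = 2 by ring] at this
        have h4 := hsmall n
        rw [Complex.norm_ofNat] at h3
        linarith
      rw [hsq, h1, norm_mul, pow_succ]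
      calc (3 / 2 : ℝ) ^ n * (3 / 2) * ‖((ψ x : Circle) : ℂ) - 1‖
          = ((3 / 2 : ℝ) ^ n * ‖((ψ x : Circle) : ℂ) - 1‖) * (3 / 2) := by ring
        _ ≤ ‖z - 1‖ * ‖z + 1‖ := by gcongr
  by_contra hne
  have hpos : 0 < ‖((ψ x : Circle) : ℂ) - 1‖ := by
    rw [norm_pos_iff, sub_ne_zero]
    intro h1
    exact hne (Circle.ext h1)
  obtain ⟨n, hn⟩ := pow_unbounded_of_one_lt (1 / ‖((ψ x : Circle) : ℂ) - 1‖)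
    (show (1 : ℝ) < 3 / 2 by norm_num)
  rw [div_lt_iff₀ hpos] at hn
  have := (hgrow n).trans_lt (hsmall n)
  linarith

end Ultrametric

end ZetaTwo

namespace ZetaTwo

open Filter Topology

/-! ### Linear recurrences -/

/-- Geometric growth of sequences that satisfy a linear recurrence from some index on. -/
theorem norm_le_geometric_of_recurrence {b : ℕ → ℂ} {D n₀ : ℕ} {c : Fin D → ℂ} {S : ℝ}
    (hS : 0 ≤ S) (hinit : ∀ n < n₀ + D, ‖b n‖ ≤ S)
    (hrec : ∀ n ≥ n₀, b (n + D) = ∑ i : Fin D, c i * b (n + i)) (n : ℕ) :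
    ‖b n‖ ≤ S * (1 + ∑ i, ‖c i‖) ^ n := by
  set R : ℝ := 1 + ∑ i, ‖c i‖ with hR
  have hsum : 0 ≤ ∑ i, ‖c i‖ := Finset.sum_nonneg fun _ _ => norm_nonneg _
  have hR1 : 1 ≤ R := le_add_of_nonneg_right hsum
  have hR0 : 0 ≤ R := zero_le_one.trans hR1
  induction n using Nat.strong_induction_on with
  | _ n ih =>
    rcases lt_or_ge n (n₀ + D) with h | h
    · exact (hinit n h).trans (le_mul_of_one_le_right hS (one_le_pow₀ hR1))
    · obtain ⟨m, rfl⟩ : ∃ m, n = m + D := ⟨n - D, by omega⟩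
      rw [hrec m (by omega)]
      -- For D = 0 the sequence vanishes from n₀ on. This case is separated because the exponent m +
      -- D - 1 below would be truncated at m = 0.
      rcases Nat.eq_zero_or_pos D with h0 | hD
      · subst h0
        simp only [Finset.univ_eq_empty, Finset.sum_empty, norm_zero]
        positivity
      have hstep : ∀ i : Fin D, ‖c i * b (m + i)‖ ≤ ‖c i‖ * (S * R ^ (m + D - 1)) := by
        intro i
        rw [norm_mul]
        have hi := i.2
        refine mul_le_mul_of_nonneg_left ((ih (m + i) (by omega)).trans ?_) (norm_nonneg _)
        exact mul_le_mul_of_nonneg_left (pow_le_pow_right₀ hR1 (by omega)) hS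
      calc ‖∑ i : Fin D, c i * b (m + i)‖ ≤ ∑ i : Fin D, ‖c i‖ * (S * R ^ (m + D - 1)) :=
            (norm_sum_le _ _).trans (Finset.sum_le_sum fun i _ => hstep i)
        _ = (∑ i, ‖c i‖) * (S * R ^ (m + D - 1)) := by rw [Finset.sum_mul]
        _ ≤ R * (S * R ^ (m + D - 1)) := by
          gcongr
          exact le_add_of_nonneg_left zero_le_one
        _ = S * R ^ (m + D) := by
          rw [mul_left_comm, ← pow_succ', Nat.sub_add_cancel (by omega)]

/-- In a finite-dimensional space some term of a sequence is a combination of earlier terms. -/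
theorem exists_eq_sum_of_finiteDimensional {V : Type*} [AddCommGroup V] [Module ℂ V]
    [FiniteDimensional ℂ V] (u : ℕ → V) : ∃ (D : ℕ) (c : Fin D → ℂ), u D = ∑ i, c i • u i := by
  have hmono : Monotone fun n => Submodule.span ℂ (Set.range fun i : Fin n => u i) := by
    intro m n hmn
    refine Submodule.span_mono ?_
    rintro _ ⟨i, rfl⟩
    exact ⟨Fin.castLE hmn i, rfl⟩
  -- The spans of the first n terms form an ascending chain; D is an index where it has stabilized.
  obtain ⟨D, hD⟩ := monotone_stabilizes_iff_noetherian.2 (inferInstanceAs (IsNoetherian ℂ V))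
    ⟨_, hmono⟩
  have h : Submodule.span ℂ (Set.range fun i : Fin D => u i) =
      Submodule.span ℂ (Set.range fun i : Fin (D + 1) => u i) := hD (D + 1) (Nat.le_succ D)
  have hmem : u D ∈ Submodule.span ℂ (Set.range fun i : Fin D => u i) := by
    rw [h]
    exact Submodule.subset_span ⟨Fin.last D, rfl⟩
  obtain ⟨c, hc⟩ := (Submodule.mem_span_range_iff_exists_fun ℂ).1 hmem
  exact ⟨D, c, hc.symm⟩

/-! ### Non-archimedean Whittaker functions on the torus -/

section NonArch

variable {F : Type*} [NontriviallyNormedField F]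
variable {V : Type*} [AddCommGroup V] [Module ℂ V] {π : Representation ℂ (GL (Fin 2) F) V}

/-- Fibers of the orbit map are left translates of the open stabilizer. -/
theorem isLocallyConstant_orbit (hπ : ∀ v : V, IsOpen {g : GL (Fin 2) F | π g v = v}) (v : V) :
    IsLocallyConstant fun g => π g v := by
  rw [IsLocallyConstant.iff_isOpen_fiber_apply]
  intro g
  have h : (fun h => π h v) ⁻¹' {π g v} = (fun h => g⁻¹ * h) ⁻¹' {h | π h v = v} := by
    ext h
    simp only [Set.mem_preimage, Set.mem_singleton_iff, Set.mem_ofPred_eq, map_mul,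
      Module.End.mul_apply]
    constructor
    · intro e
      rw [e, ← Module.End.mul_apply, ← map_mul, inv_mul_cancel, map_one, Module.End.one_apply]
    · intro e
      conv_rhs => rw [← e]
      rw [← Module.End.mul_apply, ← map_mul, mul_inv_cancel, map_one, Module.End.one_apply]
  rw [h]
  exact (hπ v).preimage (continuous_const_mul _)

theorem finite_orbit (hπ : ∀ v : V, IsOpen {g : GL (Fin 2) F | π g v = v})
    {Γ : Subgroup (GL (Fin 2) F)} (hΓ : IsCompact (Γ : Set (GL (Fin 2) F))) (v : V) :
    ((fun g => π g v) '' (Γ : Set (GL (Fin 2) F))).Finite := by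
  have : CompactSpace Γ := isCompact_iff_compactSpace.1 hΓ
  have h := ((isLocallyConstant_orbit hπ v).comp_continuous
    (continuous_subtype_val (p := (· ∈ Γ)))).range_finite
  refine h.subset ?_
  rintro _ ⟨g, hg, rfl⟩
  exact ⟨⟨g, hg⟩, rfl⟩

theorem continuous_whittaker (hπ : ∀ v : V, IsOpen {g : GL (Fin 2) F | π g v = v})
    (ℓ : V →ₗ[ℂ] ℂ) (v : V) : Continuous fun g => ℓ (π g v) :=
  ((isLocallyConstant_orbit hπ v).comp ℓ).continuous

/-- Locally constant functions with compact support are rapidly decreasing. -/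
theorem isRapidlyDecreasing_of_schwartzBruhatNA
    {f : Matrix (Fin 2) (Fin 2) F × Matrix (Fin 2) (Fin 2) F → ℂ} (hf : IsSchwartzBruhatNA f) :
    Continuous f ∧ IsRapidlyDecreasing f := by
  have hc := hf.1.continuous
  refine ⟨hc, fun P => ?_⟩
  have hsize : Continuous (entrySize : Matrix (Fin 2) (Fin 2) F → ℝ) :=
    continuous_finsetSum _ fun i _ => continuous_finsetSum _ fun j _ =>
      (continuous_id.matrix_elem i j).norm
  set g : Matrix (Fin 2) (Fin 2) F × Matrix (Fin 2) (Fin 2) F → ℝ :=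
    fun p => ‖f p‖ * (1 + entrySize p.1 + entrySize p.2) ^ P with hg
  have hgc : Continuous g := hc.norm.mul
    (((continuous_const.add (hsize.comp continuous_fst)).add (hsize.comp continuous_snd)).pow P)
  have hgs : HasCompactSupport g := hf.2.norm.mul_right
  obtain ⟨C, hC⟩ := (hgs.isCompact_range hgc).bddAbove
  exact ⟨C, fun X Y => hC ⟨(X, Y), rfl⟩⟩

variable [IsUltrametricDist F] {ψ : AddChar F Circle} {ℓ : V →ₗ[ℂ] ℂ}

/-- If ‖a‖ is large, n(x₀/a) lies in a congruence subgroup fixing v. Moving it across diag(a,1)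
turns it into n(x₀), so the value equals ψ(x₀) times itself, where ψ(x₀) ≠ 1. -/
theorem exists_torus_vanishing (hπ : ∀ v : V, IsOpen {g : GL (Fin 2) F | π g v = v})
    (hψ : ∃ x, ψ x ≠ 1) (hℓ : IsWhittakerFunctional π ψ ℓ) (v : V) :
    ∃ R : ℝ, ∀ a : Fˣ, R ≤ ‖(a : F)‖ → ℓ (π (diagOne a) v) = 0 := by
  obtain ⟨x₀, hx₀⟩ := hψ
  obtain ⟨r, hr0, hr1, hr⟩ := exists_congruenceGL_subset ((hπ v).mem_nhds
    (show (1 : GL (Fin 2) F) ∈ {g | π g v = v} by simp))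
  refine ⟨‖x₀‖ / r, fun a ha => ?_⟩
  have ha0 := norm_unit_pos a
  have hx : ‖x₀ / (a : F)‖ ≤ r := by
    rw [norm_div, div_le_iff₀ ha0]
    rwa [div_le_iff₀' hr0] at ha
  have hfix : π (unip (x₀ / (a : F))) v = v := hr (unip_mem_congruenceGL hr0 hr1.le hx)
  have h := hℓ x₀ (π (diagOne a) v)
  have hcancel : (a : F) * (x₀ / (a : F)) = x₀ := mul_div_cancel₀ _ a.ne_zero
  rw [← hcancel, ← Module.End.mul_apply, ← map_mul, ← diagOne_mul_unip, map_mul,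
    Module.End.mul_apply, hfix, hcancel] at h
  have hne : (ψ x₀ : ℂ) ≠ 1 := fun e => hx₀ (Circle.ext e)
  by_contra h0
  exact hne (mul_right_cancel₀ h0 (by rw [one_mul]; exact h.symm))

variable [ProperSpace F]

/-- A vector fixed by a congruence subgroup, translated by contracting torus elements and averaged,
satisfies a linear recurrence under every Whittaker functional near `0`. -/
theorem exists_torus_recurrence (hπ : IsAdmissibleNA π) (hψ : Continuous ψ)
    (hℓ : IsWhittakerFunctional π ψ ℓ) {p : Fˣ} (hp : ‖(p : F)‖ < 1) (v : V) :
    ∃ (D : ℕ) (c : Fin D → ℂ) (δ : ℝ), 0 < δ ∧ ∀ a : Fˣ, ‖(a : F)‖ ≤ δ →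
      ℓ (π (diagOne (a * p ^ D)) v) = ∑ i, c i * ℓ (π (diagOne (a * p ^ (i : ℕ))) v) := by
  classical
  obtain ⟨r, hr0, hr1, hr⟩ := exists_congruenceGL_subset ((hπ.smooth v).mem_nhds
    (show (1 : GL (Fin 2) F) ∈ {g | π g v = v} by simp))
  set Γ := congruenceGL (F := F) r hr0 hr1.le with hΓ
  obtain ⟨δ, hδ0, hδ⟩ := exists_addChar_trivial hψ
  have hpow : ∀ n : ℕ, ‖((p ^ n : Fˣ) : F)‖ ≤ 1 := fun n => by
    rw [Units.val_pow_eq_pow_val, norm_pow]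
    exact pow_le_one₀ (norm_nonneg _) hp.le
  set w : ℕ → V := fun n => π (diagOne (p ^ n)) v with hw
  have hfin : ∀ n, ((fun g => π g (w n)) '' (Γ : Set (GL (Fin 2) F))).Finite := fun n =>
    finite_orbit hπ.smooth (isCompact_congruenceGL hr0 hr1.le) (w n)
  set O : ℕ → Finset V := fun n => (hfin n).toFinset with hO
  -- The Γ-orbit of `w n` is finite, so the mean over it replaces a Haar integral over Γ.
  have hmemO : ∀ n x, x ∈ O n ↔ ∃ g ∈ Γ, π g (w n) = x := fun n x => by
    simp [hO]
  have hOne : ∀ n, (O n).Nonempty := fun n =>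
    ⟨w n, (hmemO n _).2 ⟨1, Γ.one_mem, by simp⟩⟩
  -- Averaging does not change the values at small a: write g = n(y)g'. Conjugated by diag(pⁿ,1), g'
  -- remains in Γ, hence fixes `w n`, and n(y) contributes ψ(ay) = 1. The bound δ does not depend on
  -- n.
  have hval : ∀ n, ∀ x ∈ O n, ∀ a : Fˣ, ‖(a : F)‖ ≤ δ →
      ℓ (π (diagOne a) x) = ℓ (π (diagOne (a * p ^ n)) v) := by
    intro n x hx a ha
    obtain ⟨g, hg, rfl⟩ := (hmemO n x).1 hx
    obtain ⟨y, g', hy, rfl, hg'⟩ := congruenceGL_decomposition hr0 hr1 hg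
    have hfix : π g' (w n) = w n := by
      have h1 : π ((diagOne (p ^ n))⁻¹ * g' * diagOne (p ^ n)) v = v := hr (hg' _ (hpow n))
      have h2 : g' * diagOne (p ^ n) =
          diagOne (p ^ n) * ((diagOne (p ^ n))⁻¹ * g' * diagOne (p ^ n)) := by group
      simp only [hw]
      rw [← Module.End.mul_apply, ← map_mul, h2, map_mul, Module.End.mul_apply, h1]
    rw [map_mul, Module.End.mul_apply, hfix, ← Module.End.mul_apply, ← map_mul, diagOne_mul_unip,
      map_mul, Module.End.mul_apply, hℓ, hδ _ (by
        rw [norm_mul]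
        exact (mul_le_of_le_one_right (norm_nonneg _) (hy.trans hr1.le)).trans ha)]
    simp only [hw]
    rw [← Module.End.mul_apply, ← map_mul, ← diagOne_mul]
    simp
  have hinv : ∀ n, ∀ g ∈ Γ, π g (∑ x ∈ O n, x) = ∑ x ∈ O n, x := by
    intro n g hg
    rw [map_sum]
    refine Finset.sum_nbij' (fun x => π g x) (fun x => π g⁻¹ x) ?_ ?_ ?_ ?_ ?_
    · intro x hx
      obtain ⟨h, hh, rfl⟩ := (hmemO n x).1 hx
      exact (hmemO n _).2 ⟨g * h, Γ.mul_mem hg hh, by rw [map_mul, Module.End.mul_apply]⟩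
    · intro x hx
      obtain ⟨h, hh, rfl⟩ := (hmemO n x).1 hx
      exact (hmemO n _).2 ⟨g⁻¹ * h, Γ.mul_mem (Γ.inv_mem hg) hh, by
        rw [map_mul, Module.End.mul_apply]⟩
    · intro x _
      rw [← Module.End.mul_apply, ← map_mul, inv_mul_cancel, map_one, Module.End.one_apply]
    · intro x _
      rw [← Module.End.mul_apply, ← map_mul, mul_inv_cancel, map_one, Module.End.one_apply]
    · intro x _
      rfl
  have : FiniteDimensional ℂ (Representation.invariants (π.comp Γ.subtype)) :=
    hπ.finite Γ (isOpen_congruenceGL hr0 hr1.le)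
  set u : ℕ → Representation.invariants (π.comp Γ.subtype) := fun n =>
    ⟨((O n).card : ℂ)⁻¹ • ∑ x ∈ O n, x, fun g => by
      have h := hinv n g g.2
      change π g (((O n).card : ℂ)⁻¹ • ∑ x ∈ O n, x) = _
      rw [map_smul, h]⟩ with hu
  have hu_val : ∀ n, ∀ a : Fˣ, ‖(a : F)‖ ≤ δ →
      ℓ (π (diagOne a) (u n : V)) = ℓ (π (diagOne (a * p ^ n)) v) := by
    intro n a ha
    have hcard : ((O n).card : ℂ) ≠ 0 := by
      exact_mod_cast (Finset.card_pos.2 (hOne n)).ne'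
    simp only [hu, map_smul, map_sum, smul_eq_mul]
    rw [Finset.sum_congr rfl fun x hx => hval n x hx a ha, Finset.sum_const, nsmul_eq_mul,
      inv_mul_cancel_left₀ hcard]
  -- A single relation among the averages, in the finite-dimensional space of Γ-invariants, gives
  -- the recurrence for all small a at once.
  obtain ⟨D, c, hc⟩ := exists_eq_sum_of_finiteDimensional u
  refine ⟨D, c, δ, hδ0, fun a ha => ?_⟩
  rw [← hu_val D a ha, hc]
  simp only [Submodule.coe_sum, Submodule.coe_smul, map_sum, map_smul, smul_eq_mul]
  exact Finset.sum_congr rfl fun i _ => by rw [hu_val _ a ha]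

/-- Near 0 the recurrence along a = u pⁿ gives geometric growth in n, that is, a power of ‖a‖⁻¹,
uniformly for u in the annulus. At infinity the function vanishes, which leaves a compact annulus.
-/
theorem exists_torus_bound (hπ : IsAdmissibleNA π) (hψ : Continuous ψ) (hψ1 : ∃ x, ψ x ≠ 1)
    (hℓ : IsWhittakerFunctional π ψ ℓ) (v : V) :
    ∃ B : ℕ, ∀ M : ℕ, ∃ C : ℝ, 0 ≤ C ∧ ∀ a : Fˣ,
      (‖(a : F)‖ ≤ 1 → ‖ℓ (π (diagOne a) v)‖ ≤ C * absMax a ^ B) ∧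
      (1 ≤ ‖(a : F)‖ → ‖ℓ (π (diagOne a) v)‖ * absMax a ^ M ≤ C) := by
  obtain ⟨p, hp⟩ := exists_unit_norm_lt_one F
  have hp0 := norm_unit_pos p
  obtain ⟨D, c, δ, hδ0, hrec⟩ := exists_torus_recurrence hπ hψ hℓ hp v
  obtain ⟨R, hR⟩ := exists_torus_vanishing hπ.smooth hψ1 hℓ v
  have hcont : Continuous fun a : Fˣ => ℓ (π (diagOne a) v) :=
    (continuous_whittaker hπ.smooth ℓ v).comp continuous_diagOne
  obtain ⟨n₀, hn₀⟩ := exists_pow_lt_of_lt_one hδ0 hp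
  -- The annulus has to contain u pᵐ for all m < n₀ + D; the additional power of p allows for ‖u‖ as
  -- small as ‖p‖.
  obtain ⟨S, hS⟩ := ((isCompact_annulus (F := F) (r := ‖(p : F)‖ ^ (n₀ + D + 1)) (R := 1)
    (pow_pos hp0 _)).image hcont.norm).bddAbove
  have hS' : ∀ a : Fˣ, ‖(p : F)‖ ^ (n₀ + D + 1) ≤ ‖(a : F)‖ → ‖(a : F)‖ ≤ 1 →
      ‖ℓ (π (diagOne a) v)‖ ≤ S := fun a h1 h2 => hS ⟨a, ⟨h1, h2⟩, rfl⟩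
  have hS0 : 0 ≤ S := (norm_nonneg _).trans
    (hS' 1 (by simpa using pow_le_one₀ hp0.le hp.le) (by simp))
  set T : ℝ := 1 + ∑ i, ‖c i‖ with hT
  have hT0 : 0 ≤ T := by positivity
  obtain ⟨B, hB⟩ := pow_unbounded_of_one_lt T ((one_lt_inv₀ hp0).2 hp)
  have hsmall : ∀ a : Fˣ, ‖(a : F)‖ ≤ 1 → ‖ℓ (π (diagOne a) v)‖ ≤ S * absMax a ^ B := by
    intro a ha
    obtain ⟨u, n, hu1, hu2, rfl⟩ := exists_eq_mul_pow hp ha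
    have hnorm : ∀ m : ℕ, ‖((u * p ^ m : Fˣ) : F)‖ = ‖(u : F)‖ * ‖(p : F)‖ ^ m := fun m => by
      simp
    have hup : ∀ m : ℕ, ‖((u * p ^ m : Fˣ) : F)‖ ≤ ‖(p : F)‖ ^ m := fun m => by
      rw [hnorm]
      exact mul_le_of_le_one_left (by positivity) hu2
    have hgeo := norm_le_geometric_of_recurrence (b := fun m => ℓ (π (diagOne (u * p ^ m)) v))
      (n₀ := n₀) (c := c) hS0 (fun m hm => hS' _ (by
          rw [hnorm, pow_succ']
          exact mul_le_mul hu1 (pow_le_pow_of_le_one hp0.le hp.le hm.le) (by positivity)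
            (norm_nonneg _))
        ((hup m).trans (pow_le_one₀ hp0.le hp.le)))
      (fun m hm => by
        have := hrec (u * p ^ m) ((hup m).trans
          ((pow_le_pow_of_le_one hp0.le hp.le hm).trans hn₀.le))
        simpa only [mul_assoc, ← pow_add] using this) n
    refine hgeo.trans (mul_le_mul_of_nonneg_left ?_ hS0)
    calc T ^ n ≤ ((‖(p : F)‖⁻¹) ^ B) ^ n := pow_le_pow_left₀ hT0 hB.le n
      _ = ((‖(p : F)‖ ^ n)⁻¹) ^ B := by rw [← inv_pow, ← pow_mul, ← pow_mul, mul_comm]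
      _ ≤ absMax (u * p ^ n) ^ B := by
        rw [absMax_of_le_one ha]
        have hpos := norm_unit_pos (u * p ^ n)
        gcongr
        exact hup n
  refine ⟨B, fun M => ?_⟩
  obtain ⟨S₂, hS₂⟩ := ((isCompact_annulus (F := F) (r := 1) (R := R) one_pos).image
    (hcont.norm.mul (continuous_absMax.pow M))).bddAbove
  refine ⟨max S S₂, le_max_of_le_left hS0, fun a => ⟨fun ha => ?_, fun ha => ?_⟩⟩
  · have := absMax_pos a
    exact (hsmall a ha).trans (by gcongr; exact le_max_left _ _)
  · rcases le_total R ‖(a : F)‖ with h | h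
    · rw [hR a h]
      simpa using Or.inl hS0
    · exact le_max_of_le_right (hS₂ ⟨a, ⟨ha, h⟩, rfl⟩)

theorem hasTorusDecay_of_mem_whittakerNA (hπ : IsAdmissibleNA π) (hψ : Continuous ψ)
    (hψ1 : ∃ x, ψ x ≠ 1) {W : GL (Fin 2) F → ℂ} (hW : W ∈ whittakerNA π ψ) :
    Continuous W ∧ HasTorusDecay (integralGL F) W := by
  obtain ⟨ℓ, hℓ, v, rfl⟩ := hW
  refine ⟨continuous_whittaker hπ.smooth ℓ v, ?_⟩
  have hfin := finite_orbit hπ.smooth (Γ := integralGL F) (isCompact_bounded_GL 1) v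
  choose B hB using fun w => exists_torus_bound hπ hψ hψ1 hℓ w
  choose C hC0 hC using hB
  -- The vectors π(k)v for k in the maximal compact subgroup are finitely many; summing their
  -- exponents and constants makes the bound uniform in k.
  refine ⟨∑ w ∈ hfin.toFinset, B w, fun M => ⟨∑ w ∈ hfin.toFinset, C w M,
    Finset.sum_nonneg fun w _ => hC0 w M, fun k hk a => ?_⟩⟩
  have hmem : π k v ∈ hfin.toFinset := by
    rw [Set.Finite.mem_toFinset]
    exact ⟨k, hk, rfl⟩
  have hBle := Finset.single_le_sum (f := B) (fun _ _ => Nat.zero_le _) hmem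
  have hCle := Finset.single_le_sum (f := fun w => C w M) (fun w _ => hC0 w M) hmem
  have heq : ℓ (π (diagOne a * k) v) = ℓ (π (diagOne a) (π k v)) := by
    rw [map_mul, Module.End.mul_apply]
  simp only [heq]
  refine ⟨fun ha => ((hC _ M a).1 ha).trans ?_, fun ha => ((hC _ M a).2 ha).trans hCle⟩
  have h1 := one_le_absMax a
  have h0 := absMax_pos a
  have := (hC0 (π k v) M).trans hCle
  gcongr

end NonArch

end ZetaTwo

namespace ZetaTwo

open Filter Topology Function
open scoped ContDiff

/-! ### Finite differences of smooth functions -/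

theorem fwdDiff_iter_map {M G G' : Type*} [AddCommMonoid M] [AddCommGroup G] [AddCommGroup G']
    (L : G →+ G') (f : M → G) (h : M) (n : ℕ) (x : M) :
    (fwdDiff h)^[n] (fun t => L (f t)) x = L ((fwdDiff h)^[n] f x) := by
  simp only [fwdDiff_iter_eq_sum_shift, map_sum, map_zsmul]

theorem hasDerivAt_fwdDiff_iter {Y : Type*} [NormedAddCommGroup Y] [NormedSpace ℝ Y] {f : ℝ → Y}
    (hf : Differentiable ℝ f) (n : ℕ) (x : ℝ) :
    HasDerivAt ((fwdDiff 1)^[n] f) ((fwdDiff 1)^[n] (deriv f) x) x := by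
  induction n generalizing x with
  | zero => simpa using (hf x).hasDerivAt
  | succ n ih =>
    simp only [iterate_succ_apply', fwdDiff]
    exact ((ih (x + 1)).comp_add_const x 1).sub (ih x)

/-- Differences commute with the derivative, so one application of the mean value inequality on [x,
x+1] trades one difference of f for f'. -/
theorem norm_fwdDiff_iter_le {Y : Type*} [NormedAddCommGroup Y] [NormedSpace ℝ Y] {f : ℝ → Y}
    (hf : ContDiff ℝ ∞ f) {n : ℕ} {x C : ℝ}
    (hC : ∀ r ∈ Set.Icc x (x + n), ‖iteratedDeriv n f r‖ ≤ C) : ‖(fwdDiff 1)^[n] f x‖ ≤ C := by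
  induction n generalizing f x with
  | zero => simpa using hC x (by simp)
  | succ n ih =>
    have hdiff : Differentiable ℝ f := hf.differentiable (by simp)
    have hf' : ContDiff ℝ ∞ (deriv f) := (contDiff_infty_iff_deriv.1 hf).2
    have hbound : ∀ r ∈ Set.Icc x (x + 1), ‖(fwdDiff 1)^[n] (deriv f) r‖ ≤ C := by
      intro r hr
      refine ih hf' fun s hs => ?_
      rw [← iteratedDeriv_succ']
      refine hC s ⟨hr.1.trans hs.1, ?_⟩
      push_cast
      linarith [hs.2, hr.2]
    have h := (convex_Icc x (x + 1)).norm_image_sub_le_of_norm_hasDerivWithin_le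
      (fun r _ => (hasDerivAt_fwdDiff_iter hdiff n r).hasDerivWithinAt) hbound
      (Set.left_mem_Icc.2 (by simp)) (Set.right_mem_Icc.2 (by simp))
    simpa [iterate_succ_apply', fwdDiff] using h

section Calculus

variable {X Y Z : Type*} [NormedAddCommGroup X] [NormedSpace ℝ X] [NormedAddCommGroup Y]
  [NormedSpace ℝ Y] [NormedAddCommGroup Z] [NormedSpace ℝ Z]

/-- A chain rule serving three affine substitutions: conjugation by the torus, the slice y ↦ (y, t,
k), and lines in the unipotent direction. Smoothness only on an open set is required, as orbit maps
are smooth only at invertible matrices. -/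
theorem iteratedFDeriv_comp_affine {f : X → Y} {Ω : Set X} (hΩ : IsOpen Ω)
    (hf : ContDiffOn ℝ ∞ f Ω) (p₀ : X) (g : Z →L[ℝ] X) {z : Z} (hz : p₀ + g z ∈ Ω) (i : ℕ) :
    iteratedFDeriv ℝ i (fun z => f (p₀ + g z)) z =
      (iteratedFDeriv ℝ i f (p₀ + g z)).compContinuousLinearMap fun _ => g := by
  set Ω' : Set X := (fun x => p₀ + x) ⁻¹' Ω with hΩ'
  have ho : IsOpen Ω' := hΩ.preimage (continuous_const_add p₀)
  have hf' : ContDiffOn ℝ ∞ (fun x => f (p₀ + x)) Ω' :=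
    hf.comp (contDiff_const.add contDiff_id).contDiffOn fun _ hx => hx
  have ho' : IsOpen (g ⁻¹' Ω') := ho.preimage g.continuous
  have h := g.iteratedFDerivWithin_comp_right (x := z) hf' ho.uniqueDiffOn ho'.uniqueDiffOn hz
    (i := i) (by exact_mod_cast le_top)
  rw [iteratedFDerivWithin_of_isOpen i ho' hz, iteratedFDerivWithin_of_isOpen i ho hz,
    iteratedFDeriv_comp_add_left] at h
  exact h

theorem norm_iteratedFDeriv_comp_affine_le {f : X → Y} {Ω : Set X} (hΩ : IsOpen Ω)
    (hf : ContDiffOn ℝ ∞ f Ω) (p₀ : X) (g : Z →L[ℝ] X) {z : Z} (hz : p₀ + g z ∈ Ω) (i : ℕ) :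
    ‖iteratedFDeriv ℝ i (fun z => f (p₀ + g z)) z‖ ≤
      ‖iteratedFDeriv ℝ i f (p₀ + g z)‖ * ‖g‖ ^ i := by
  rw [iteratedFDeriv_comp_affine hΩ hf p₀ g hz]
  refine (ContinuousMultilinearMap.norm_compContinuousLinearMap_le _ _).trans_eq ?_
  simp

theorem contDiffOn_iteratedFDeriv {f : X → Y} {Ω : Set X} (hΩ : IsOpen Ω)
    (hf : ContDiffOn ℝ ∞ f Ω) (i : ℕ) : ContDiffOn ℝ ∞ (iteratedFDeriv ℝ i f) Ω := by
  intro x hx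
  exact ((hf.contDiffAt (hΩ.mem_nhds hx)).iteratedFDeriv_right (m := ∞) (i := i)
    (by exact_mod_cast le_top)).contDiffWithinAt

/-- Finite differences along a line are controlled by derivatives. -/
theorem norm_fwdDiff_iter_line_le {f : X → Y} {Ω : Set X} (hΩ : IsOpen Ω)
    (hf : ContDiffOn ℝ ∞ f Ω) {p₀ w : X} (hline : ∀ r : ℝ, p₀ + r • w ∈ Ω) {n : ℕ} {C : ℝ}
    (hC : ∀ r ∈ Set.Icc (0 : ℝ) n, ‖iteratedFDeriv ℝ n f (p₀ + r • w)‖ ≤ C) :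
    ‖(fwdDiff 1)^[n] (fun r : ℝ => f (p₀ + r • w)) 0‖ ≤ C * ‖w‖ ^ n := by
  set g : ℝ →L[ℝ] X := ContinuousLinearMap.toSpanSingleton ℝ w with hg
  have hsmooth : ContDiff ℝ ∞ fun r : ℝ => f (p₀ + r • w) := by
    rw [← contDiffOn_univ]
    exact hf.comp (contDiff_const.add (contDiff_id.smul contDiff_const)).contDiffOn
      fun r _ => hline r
  refine norm_fwdDiff_iter_le hsmooth fun r hr => ?_
  rw [zero_add] at hr
  rw [← norm_iteratedFDeriv_eq_norm_iteratedDeriv]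
  have h := norm_iteratedFDeriv_comp_affine_le hΩ hf p₀ g (z := r) (hline r) n
  rw [hg, ContinuousLinearMap.norm_toSpanSingleton] at h
  exact h.trans (mul_le_mul_of_nonneg_right (hC r hr) (by positivity))

end Calculus

end ZetaTwo

namespace ZetaTwo

open Filter Topology Function
open scoped ContDiff

section Arch

variable {𝕜 : Type*} [RCLike 𝕜]

/-! ### The maximal compact subgroup and coordinates -/

theorem unitaryGL_bounded : ∀ k ∈ unitaryGL 𝕜, ∀ i j, ‖k.val i j‖ ≤ 1 := by
  intro k hk i j
  refine entry_norm_bound_of_unitary (U := k.val) ?_ i j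
  rw [Matrix.mem_unitaryGroup_iff']
  exact hk

theorem isCompact_unitaryGL : IsCompact (unitaryGL 𝕜 : Set (GL (Fin 2) 𝕜)) := by
  refine (isCompact_bounded_GL 1).of_isClosed_subset ?_ fun k hk =>
    ⟨unitaryGL_bounded k hk, unitaryGL_bounded _ ((unitaryGL 𝕜).inv_mem hk)⟩
  exact isClosed_eq (Units.continuous_val.matrix_conjTranspose.matrix_mul Units.continuous_val)
    continuous_const

instance compactSpace_unitaryGL : CompactSpace (unitaryGL 𝕜) :=
  isCompact_iff_compactSpace.1 isCompact_unitaryGL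

/-- The matrix coordinates of an invertible matrix. -/
def coords (g : GL (Fin 2) 𝕜) : Fin 2 → Fin 2 → 𝕜 := fun i j => g.val i j

theorem continuous_coords : Continuous (coords : GL (Fin 2) 𝕜 → Fin 2 → Fin 2 → 𝕜) :=
  continuous_pi fun i => continuous_pi fun j => Units.continuous_val.matrix_elem i j

theorem coords_mem (g : GL (Fin 2) 𝕜) : coords g ∈ invertibleSet 𝕜 := g.isUnit

theorem exists_coords_eq {x : Fin 2 → Fin 2 → 𝕜} (hx : x ∈ invertibleSet 𝕜) :
    ∃ g, coords g = x := by
  obtain ⟨g, hg⟩ := hx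
  exact ⟨g, funext fun i => funext fun j => congrFun (congrFun hg i) j⟩

theorem isOpen_invertibleSet : IsOpen (invertibleSet 𝕜) := by
  have h : invertibleSet 𝕜 = {x | x 0 0 * x 1 1 - x 0 1 * x 1 0 ≠ 0} := by
    ext x
    change IsUnit (Matrix.of x) ↔ _
    rw [Matrix.isUnit_iff_isUnit_det, isUnit_iff_ne_zero, Matrix.det_fin_two]
    rfl
  rw [h]
  exact isOpen_ne_fun (by fun_prop) continuous_const

/-- The map `(y, t, k) ↦ y n(t) k` in matrix coordinates. -/
def unipProd (p : (Fin 2 → Fin 2 → 𝕜) × 𝕜 × (Fin 2 → Fin 2 → 𝕜)) : Fin 2 → Fin 2 → 𝕜 :=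
  fun i j => p.1 i 0 * (p.2.2 0 j + p.2.1 * p.2.2 1 j) + p.1 i 1 * p.2.2 1 j

theorem contDiff_unipProd : ContDiff ℝ ∞ (unipProd (𝕜 := 𝕜)) := by
  unfold unipProd
  fun_prop

theorem unipProd_coords (y : Fin 2 → Fin 2 → 𝕜) (t : 𝕜) (k : GL (Fin 2) 𝕜) :
    Matrix.of (unipProd (y, t, coords k)) = Matrix.of y * (unip t * k).val := by
  ext i j
  rw [Units.val_mul]
  simp only [Matrix.mul_apply, Fin.sum_univ_two]
  simp [unipProd, coords, unip, GeneralLinearGroup.upperRightHom]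

/-- The set of `(y, t, k)` with `y` and `k` such that `y n(t) k` is invertible. -/
def unipProdDomain (𝕜 : Type*) [RCLike 𝕜] : Set ((Fin 2 → Fin 2 → 𝕜) × 𝕜 × (Fin 2 → Fin 2 → 𝕜)) :=
  unipProd ⁻¹' invertibleSet 𝕜

theorem isOpen_unipProdDomain : IsOpen (unipProdDomain 𝕜) :=
  isOpen_invertibleSet.preimage contDiff_unipProd.continuous

theorem mem_unipProdDomain (g : GL (Fin 2) 𝕜) (t : 𝕜) (k : GL (Fin 2) 𝕜) :
    (coords g, t, coords k) ∈ unipProdDomain 𝕜 := by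
  change IsUnit (Matrix.of _)
  rw [unipProd_coords]
  exact (g * (unip t * k)).isUnit

variable {H : Type*} [NormedAddCommGroup H] [NormedSpace ℂ H]
variable {π : GL (Fin 2) 𝕜 →* (H →L[ℂ] H)}

/-! ### Derivatives of orbit maps -/

theorem orbitMap_coords (v : H) (g : GL (Fin 2) 𝕜) : orbitMap π v (coords g) = π g v := by
  have h : IsUnit (Matrix.of (coords g)) := coords_mem g
  have hu : h.unit = g := Units.ext rfl
  rw [orbitMap, dif_pos h, hu]

theorem orbitMap_of_notMem (v : H) {x : Fin 2 → Fin 2 → 𝕜} (hx : x ∉ invertibleSet 𝕜) :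
    orbitMap π v x = 0 := dif_neg hx

/-- Both sides are 0 at singular y, so this is an identity of functions on the whole matrix space
and can be differentiated in y. -/
theorem orbitMap_translate (v : H) (t : 𝕜) (k : GL (Fin 2) 𝕜) (y : Fin 2 → Fin 2 → 𝕜) :
    orbitMap π (π (unip t * k) v) y = orbitMap π v (unipProd (y, t, coords k)) := by
  by_cases hy : y ∈ invertibleSet 𝕜
  · obtain ⟨g, rfl⟩ := exists_coords_eq hy
    have h : unipProd (coords g, t, coords k) = coords (g * (unip t * k)) := by
      have := unipProd_coords (coords g) t k
      funext i j
      exact congrFun (congrFun this i) j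
    rw [h, orbitMap_coords, orbitMap_coords, map_mul π g]
    rfl
  · have h : unipProd (y, t, coords k) ∉ invertibleSet 𝕜 := by
      intro h
      change IsUnit (Matrix.of _) at h
      rw [unipProd_coords, Units.isUnit_mul_units] at h
      exact hy h
    rw [orbitMap_of_notMem _ hy, orbitMap_of_notMem _ h]

/-- The conjugation `y ↦ d⁻¹ y d` by `d = diag(a, 1)` in matrix coordinates. -/
noncomputable def conjDiag (a : 𝕜ˣ) : (Fin 2 → Fin 2 → 𝕜) →L[ℝ] (Fin 2 → Fin 2 → 𝕜) :=
  LinearMap.mkContinuous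
    { toFun := fun y => ![![y 0 0, (a : 𝕜)⁻¹ * y 0 1], ![(a : 𝕜) * y 1 0, y 1 1]]
      map_add' := fun y z => by
        ext i j
        fin_cases i <;> fin_cases j <;> simp [mul_add]
      map_smul' := fun c y => by
        ext i j
        fin_cases i <;> fin_cases j <;> simp }
    (absMax a) fun y => by
      have hm := absMax_pos a
      have h1 := one_le_absMax a
      have hy : ∀ i j, ‖y i j‖ ≤ ‖y‖ := fun i j => (norm_le_pi_norm (y i) j).trans
        (norm_le_pi_norm y i)
      have hle : ∀ i j, ‖y i j‖ ≤ absMax a * ‖y‖ := fun i j =>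
        (hy i j).trans (le_mul_of_one_le_left (norm_nonneg _) h1)
      refine (pi_norm_le_iff_of_nonneg (by positivity)).2 fun i =>
        (pi_norm_le_iff_of_nonneg (by positivity)).2 fun j => ?_
      fin_cases i <;> fin_cases j <;> simp
      · exact hle 0 0
      · exact mul_le_mul (le_max_right _ _) (hy 0 1) (norm_nonneg _) hm.le
      · exact mul_le_mul (le_max_left _ _) (hy 1 0) (norm_nonneg _) hm.le
      · exact hle 1 1

theorem norm_conjDiag_le (a : 𝕜ˣ) : ‖conjDiag a‖ ≤ absMax a :=
  LinearMap.mkContinuous_norm_le _ (absMax_pos a).le _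

theorem conjDiag_coords (a : 𝕜ˣ) (g : GL (Fin 2) 𝕜) :
    conjDiag a (coords g) = coords ((diagOne a)⁻¹ * g * diagOne a) := by
  funext i j
  rw [coords, conj_diagOne_apply]
  fin_cases i <;> fin_cases j <;> rfl

theorem conjDiag_mem_iff (a : 𝕜ˣ) (y : Fin 2 → Fin 2 → 𝕜) :
    conjDiag a y ∈ invertibleSet 𝕜 ↔ y ∈ invertibleSet 𝕜 := by
  constructor
  · intro h
    obtain ⟨g, hg⟩ := exists_coords_eq h
    have hy : y = coords (diagOne a * g * (diagOne a)⁻¹) := by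
      have h1 : conjDiag a⁻¹ (conjDiag a y) = y := by
        funext i j
        change (![![_, _], ![_, _]] : Fin 2 → Fin 2 → 𝕜) i j = _
        fin_cases i <;> fin_cases j <;> simp [conjDiag]
      have hinv : (diagOne a⁻¹ : GL (Fin 2) 𝕜) = (diagOne a)⁻¹ := by
        rw [eq_inv_iff_mul_eq_one, ← diagOne_mul, inv_mul_cancel, diagOne_one]
      rw [← h1, ← hg, conjDiag_coords, hinv, inv_inv]
    rw [hy]
    exact coords_mem _
  · intro h
    obtain ⟨g, rfl⟩ := exists_coords_eq h
    rw [conjDiag_coords]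
    exact coords_mem _

/-- From yd = d(d⁻¹yd): the torus element moves to the left, where it acts by a bounded operator,
and the derivatives only see a linear substitution of norm at most `absMax a`. -/
theorem orbitMap_diagOne (v : H) (a : 𝕜ˣ) (y : Fin 2 → Fin 2 → 𝕜) :
    orbitMap π (π (diagOne a) v) y = π (diagOne a) (orbitMap π v (conjDiag a y)) := by
  by_cases hy : y ∈ invertibleSet 𝕜
  · obtain ⟨g, rfl⟩ := exists_coords_eq hy
    rw [conjDiag_coords, orbitMap_coords, orbitMap_coords, ← mul_apply_eq_comp,
      ← mul_apply_eq_comp, ← map_mul, ← map_mul]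
    congr 2
    group
  · rw [orbitMap_of_notMem _ hy, orbitMap_of_notMem _ (fun h => hy ((conjDiag_mem_iff a y).1 h)),
      map_zero]

theorem contDiffAt_orbitMap (v : smoothVectors π) (g : GL (Fin 2) 𝕜) :
    ContDiffAt ℝ ∞ (orbitMap π (v : H)) (coords g) :=
  ContDiffOn.contDiffAt v.2 (isOpen_invertibleSet.mem_nhds (coords_mem g))

theorem orbitMap_add (v w : H) : orbitMap π (v + w) = orbitMap π v + orbitMap π w := by
  funext x
  by_cases h : IsUnit (Matrix.of x) <;> simp [orbitMap, h]

/-- The `j`-th derivative of the orbit map at the identity, as an additive map. -/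
noncomputable def orbitDeriv (π : GL (Fin 2) 𝕜 →* (H →L[ℂ] H)) (j : ℕ) :
    smoothVectors π →+ ContinuousMultilinearMap ℝ (fun _ : Fin j => Fin 2 → Fin 2 → 𝕜) H :=
  AddMonoidHom.mk' (fun v => iteratedFDeriv ℝ j (orbitMap π (v : H)) (coords 1)) fun v w => by
    rw [Submodule.coe_add, orbitMap_add]
    exact iteratedFDeriv_add_apply ((contDiffAt_orbitMap v 1).of_le (by exact_mod_cast le_top))
      ((contDiffAt_orbitMap w 1).of_le (by exact_mod_cast le_top))

theorem smoothSeminorm_eq (j : ℕ) (v : smoothVectors π) :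
    smoothSeminorm π j v = ‖orbitDeriv π j v‖ := rfl

/-- Effect of the torus on the seminorms of smooth vectors. -/
theorem norm_orbitDeriv_diagOne_le (j : ℕ) (v : smoothVectors π) (a : 𝕜ˣ) :
    ‖orbitDeriv π j (smoothRep π (diagOne a) v)‖ ≤
      ‖π (diagOne a)‖ * (‖orbitDeriv π j v‖ * absMax a ^ j) := by
  have hone : conjDiag a (coords 1) = coords (1 : GL (Fin 2) 𝕜) := by
    rw [conjDiag_coords]; simp
  have hmem : (0 : Fin 2 → Fin 2 → 𝕜) + conjDiag a (coords 1) ∈ invertibleSet 𝕜 := by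
    rw [zero_add, hone]; exact coords_mem 1
  have hfun : orbitMap π ((smoothRep π (diagOne a) v : smoothVectors π) : H) =
      ((π (diagOne a)).restrictScalars ℝ : H →L[ℝ] H) ∘
        fun y => orbitMap π (v : H) (0 + conjDiag a y) := by
    funext y
    rw [Function.comp_apply, zero_add]
    exact orbitMap_diagOne (v : H) a y
  have hsm : ContDiffAt ℝ ∞ (fun y => orbitMap π (v : H) (0 + conjDiag a y)) (coords 1) := by
    refine ContDiffAt.comp (g := orbitMap π (v : H)) _ ?_
      (contDiff_const.add (conjDiag a).contDiff).contDiffAt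
    rw [zero_add, hone]
    exact contDiffAt_orbitMap v 1
  change ‖iteratedFDeriv ℝ j _ _‖ ≤ _
  rw [hfun]
  refine (ContinuousLinearMap.norm_iteratedFDeriv_comp_left _ hsm
    (by exact_mod_cast le_top)).trans ?_
  rw [ContinuousLinearMap.norm_restrictScalars]
  refine mul_le_mul_of_nonneg_left ?_ (norm_nonneg _)
  refine (norm_iteratedFDeriv_comp_affine_le isOpen_invertibleSet v.2 0 (conjDiag a) hmem j).trans ?_
  rw [zero_add, hone]
  gcongr
  · exact le_rfl
  · exact norm_conjDiag_le a

/-- The derivatives at the identity of the orbit maps of `π (n(t) k) v`, as a function of `t` and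
of the coordinates of `k`. -/
theorem exists_orbitDeriv_smooth (j : ℕ) (v : smoothVectors π) :
    ∃ Φ : (Fin 2 → Fin 2 → 𝕜) × 𝕜 × (Fin 2 → Fin 2 → 𝕜) →
        ContinuousMultilinearMap ℝ (fun _ : Fin j => Fin 2 → Fin 2 → 𝕜) H,
      ContDiffOn ℝ ∞ Φ (unipProdDomain 𝕜) ∧ ∀ t k,
        orbitDeriv π j (smoothRep π (unip t * k) v) = Φ (coords 1, t, coords k) := by
  set G : (Fin 2 → Fin 2 → 𝕜) × 𝕜 × (Fin 2 → Fin 2 → 𝕜) → H :=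
    fun p => orbitMap π (v : H) (unipProd p) with hG
  have hGs : ContDiffOn ℝ ∞ G (unipProdDomain 𝕜) :=
    ContDiffOn.comp v.2 contDiff_unipProd.contDiffOn fun _ hp => hp
  set inl : (Fin 2 → Fin 2 → 𝕜) →L[ℝ] (Fin 2 → Fin 2 → 𝕜) × 𝕜 × (Fin 2 → Fin 2 → 𝕜) :=
    ContinuousLinearMap.inl ℝ _ _ with hinl
  -- The derivative in y alone is the full derivative of G in (y, t, k) restricted to the first
  -- factor; this makes its smooth dependence on t and k evident.
  refine ⟨fun p => ContinuousMultilinearMap.compContinuousLinearMapL (fun _ => inl)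
    (iteratedFDeriv ℝ j G p), ?_, fun t k => ?_⟩
  · exact (ContinuousLinearMap.contDiff _).comp_contDiffOn
      (contDiffOn_iteratedFDeriv isOpen_unipProdDomain hGs j)
  · have hp : ∀ y : Fin 2 → Fin 2 → 𝕜,
        ((0, t, coords k) : (Fin 2 → Fin 2 → 𝕜) × 𝕜 × (Fin 2 → Fin 2 → 𝕜)) + inl y =
          (y, t, coords k) := fun y => by simp [hinl]
    have hfun : orbitMap π ((smoothRep π (unip t * k) v : smoothVectors π) : H) =
        fun y => G ((0, t, coords k) + inl y) := by
      funext y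
      rw [hp]
      exact orbitMap_translate (v : H) t k y
    change iteratedFDeriv ℝ j (orbitMap π _) (coords 1) = _
    rw [hfun, iteratedFDeriv_comp_affine isOpen_unipProdDomain hGs _ inl
      (by rw [hp]; exact mem_unipProdDomain 1 t k), hp]
    rfl

/-- Iterated differences along the unipotent subgroup are small in the topology of the smooth
vectors, uniformly over the maximal compact subgroup. -/
theorem exists_norm_orbitDeriv_fwdDiff_le (j M : ℕ) (v : smoothVectors π) (T : ℝ) :
    ∃ C : ℝ, 0 ≤ C ∧ ∀ k ∈ unitaryGL 𝕜, ∀ h : 𝕜, ‖h‖ ≤ T →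
      ‖orbitDeriv π j ((fwdDiff h)^[M] (fun t => smoothRep π (unip t * k) v) 0)‖ ≤
        C * ‖h‖ ^ M := by
  obtain ⟨Φ, hΦ, hval⟩ := exists_orbitDeriv_smooth j v
  -- A compact set containing all segments t = rh with 0 ≤ r ≤ M and ‖h‖ ≤ T, for every k in the
  -- maximal compact subgroup.
  set S : Set ((Fin 2 → Fin 2 → 𝕜) × 𝕜 × (Fin 2 → Fin 2 → 𝕜)) :=
    {coords 1} ×ˢ (Metric.closedBall (0 : 𝕜) (M * T) ×ˢ
      (coords '' (unitaryGL 𝕜 : Set (GL (Fin 2) 𝕜)))) with hS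
  have hSc : IsCompact S := isCompact_singleton.prod ((isCompact_closedBall _ _).prod
    (isCompact_unitaryGL.image continuous_coords))
  have hSΩ : S ⊆ unipProdDomain 𝕜 := by
    rintro ⟨y, t, k⟩ ⟨rfl, _, ⟨k, _, rfl⟩⟩
    exact mem_unipProdDomain 1 t k
  obtain ⟨C, hC⟩ := (hSc.image_of_continuousOn
    ((contDiffOn_iteratedFDeriv isOpen_unipProdDomain hΦ M).continuousOn.mono hSΩ).norm).bddAbove
  refine ⟨max C 0, le_max_right _ _, fun k hk h hh => ?_⟩
  set w : (Fin 2 → Fin 2 → 𝕜) × 𝕜 × (Fin 2 → Fin 2 → 𝕜) := (0, h, 0) with hw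
  have hline : ∀ r : ℝ, ((coords 1, 0, coords k) :
      (Fin 2 → Fin 2 → 𝕜) × 𝕜 × (Fin 2 → Fin 2 → 𝕜)) + r • w = (coords 1, r • h, coords k) :=
    fun r => by simp [hw]
  have hnw : ‖w‖ = ‖h‖ := by simp [hw, Prod.norm_def]
  -- Differences of step h in 𝕜 become differences of step 1 along the real line r ↦ rh, whose
  -- direction has norm ‖h‖.
  have heq : orbitDeriv π j ((fwdDiff h)^[M] (fun t => smoothRep π (unip t * k) v) 0) =
      (fwdDiff 1)^[M] (fun r : ℝ => Φ ((coords 1, 0, coords k) + r • w)) 0 := by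
    rw [← fwdDiff_iter_map]
    simp only [fwdDiff_iter_eq_sum_shift, hval, hline]
    refine Finset.sum_congr rfl fun i _ => ?_
    congr 4
    simp [RCLike.real_smul_eq_coe_mul]
  rw [heq, ← hnw]
  refine norm_fwdDiff_iter_line_le isOpen_unipProdDomain hΦ
    (fun r => by rw [hline]; exact mem_unipProdDomain 1 _ k) fun r hr => ?_
  refine le_max_of_le_left (hC ⟨_, ?_, rfl⟩)
  rw [hline]
  refine ⟨rfl, ?_, k, hk, rfl⟩
  rw [mem_closedBall_zero_iff, norm_smul, Real.norm_of_nonneg hr.1]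
  exact mul_le_mul hr.2 hh (norm_nonneg _) (Nat.cast_nonneg _)

theorem continuous_orbitDeriv (j : ℕ) (v : smoothVectors π) :
    Continuous fun g => orbitDeriv π j (smoothRep π g v) := by
  obtain ⟨Φ, hΦ, hval⟩ := exists_orbitDeriv_smooth j v
  have h : (fun g => orbitDeriv π j (smoothRep π g v)) =
      fun g => Φ (coords 1, 0, coords g) := by
    funext g
    rw [← hval]
    congr 3
    simp [unip]
  rw [h]
  exact hΦ.continuousOn.comp_continuous
    (continuous_const.prodMk (continuous_const.prodMk continuous_coords))
    fun g => mem_unipProdDomain 1 0 g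

/-! ### Archimedean Whittaker functions -/

/-- Strong continuity and the uniform boundedness principle bound the operator norms on compact
sets; submultiplicativity does the rest. -/
theorem exists_norm_torus_le [CompleteSpace H] (hπ : ∀ v : H, Continuous fun g => π g v) :
    ∃ (C : ℝ) (A : ℕ), 0 ≤ C ∧ ∀ a : 𝕜ˣ, ‖π (diagOne a)‖ ≤ C * absMax a ^ A := by
  refine submultiplicative_le_absMax_pow (fun a => norm_nonneg _) (fun a b => ?_) fun S hS => ?_
  · rw [diagOne_mul, map_mul]
    exact norm_mul_le _ _
  · obtain ⟨C, hC⟩ := banach_steinhaus (g := fun a : S => π (diagOne (a : 𝕜ˣ))) fun v => by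
      obtain ⟨C, hC⟩ := (hS.image ((hπ v).comp continuous_diagOne).norm).bddAbove
      exact ⟨C, fun a => hC ⟨a, a.2, rfl⟩⟩
    exact ⟨C, fun a ha => hC ⟨a, ha⟩⟩

theorem exists_whittaker_bound {ℓ : smoothVectors π →ₗ[ℂ] ℂ} (hℓ : IsSmoothContinuous π ℓ) :
    ∃ (N : ℕ) (C : ℝ), 0 ≤ C ∧ ∀ v, ‖ℓ v‖ ≤ C * ∑ j ∈ Finset.range (N + 1), ‖orbitDeriv π j v‖ := by
  obtain ⟨N, C, h⟩ := hℓ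
  refine ⟨N, max C 0, le_max_right _ _, fun v => (h v).trans ?_⟩
  simp only [smoothSeminorm_eq]
  exact mul_le_mul_of_nonneg_right (le_max_left _ _)
    (Finset.sum_nonneg fun _ _ => norm_nonneg _)

theorem continuous_whittakerArch {ℓ : smoothVectors π →ₗ[ℂ] ℂ} (hℓ : IsSmoothContinuous π ℓ)
    (v : smoothVectors π) : Continuous fun g => ℓ (smoothRep π g v) := by
  obtain ⟨N, C, _, h⟩ := exists_whittaker_bound hℓ
  refine continuous_iff_continuousAt.2 fun g₀ => ?_
  rw [ContinuousAt, tendsto_iff_norm_sub_tendsto_zero]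
  have hlim : Tendsto (fun g => C * ∑ j ∈ Finset.range (N + 1),
      ‖orbitDeriv π j (smoothRep π g v) - orbitDeriv π j (smoothRep π g₀ v)‖) (𝓝 g₀) (𝓝 0) := by
    have h0 : Continuous fun g => C * ∑ j ∈ Finset.range (N + 1),
        ‖orbitDeriv π j (smoothRep π g v) - orbitDeriv π j (smoothRep π g₀ v)‖ :=
      continuous_const.mul (continuous_finsetSum _ fun j _ =>
        ((continuous_orbitDeriv j v).sub continuous_const).norm)
    simpa using h0.tendsto g₀
  refine squeeze_zero (fun _ => norm_nonneg _) (fun g => ?_) hlim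
  rw [← map_sub]
  refine (h _).trans_eq ?_
  simp only [map_sub]

/-- As a function of t, the functional evaluated along n(t) is a multiple of the character t ↦
ψ(at), an eigenfunction of the difference operator. This replaces differentiation along the Lie
algebra. -/
theorem whittaker_fwdDiff {ψ : AddChar 𝕜 Circle} {ℓ : smoothVectors π →ₗ[ℂ] ℂ}
    (hℓ : IsWhittakerFunctional (smoothRep π) ψ ℓ) (v : smoothVectors π) (a : 𝕜ˣ)
    (k : GL (Fin 2) 𝕜) (h : 𝕜) (M : ℕ) :
    ℓ (smoothRep π (diagOne a) ((fwdDiff h)^[M] (fun t => smoothRep π (unip t * k) v) 0)) =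
      ((ψ (a * h) : ℂ) - 1) ^ M * ℓ (smoothRep π (diagOne a * k) v) := by
  set W : ℂ := ℓ (smoothRep π (diagOne a * k) v) with hW
  have hval : ∀ t : 𝕜, ℓ (smoothRep π (diagOne a) (smoothRep π (unip t * k) v)) =
      (ψ (a * t) : ℂ) * W := by
    intro t
    rw [← Module.End.mul_apply, ← map_mul, ← mul_assoc, diagOne_mul_unip, mul_assoc, map_mul,
      Module.End.mul_apply, hℓ]
  have hmap := fwdDiff_iter_map ((ℓ ∘ₗ smoothRep π (diagOne a)).toAddMonoidHom)
    (fun t => smoothRep π (unip t * k) v) h M 0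
  refine hmap.symm.trans ?_
  have hfun : (fun t : 𝕜 => (ℓ ∘ₗ smoothRep π (diagOne a)).toAddMonoidHom
      (smoothRep π (unip t * k) v)) = fun t => (ψ (a * t) : ℂ) * W := funext hval
  rw [hfun]
  have hgen : ∀ (n : ℕ) (x : 𝕜), (fwdDiff h)^[n] (fun t => (ψ (a * t) : ℂ) * W) x =
      ((ψ (a * h) : ℂ) - 1) ^ n * ((ψ (a * x) : ℂ) * W) := by
    intro n
    induction n with
    | zero => simp
    | succ n ih =>
      intro x
      rw [iterate_succ_apply', fwdDiff, ih, ih, mul_add, AddChar.map_add_eq_mul, Circle.coe_mul]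
      ring
  rw [hgen]
  simp

theorem hasTorusDecay_of_mem_whittakerArch [CompleteSpace H]
    (hπ : ∀ v : H, Continuous fun g => π g v) {ψ : AddChar 𝕜 Circle} (hψ : ∃ x, ψ x ≠ 1)
    {W : GL (Fin 2) 𝕜 → ℂ} (hW : W ∈ whittakerArch π ψ) :
    Continuous W ∧ HasTorusDecay (unitaryGL 𝕜) W := by
  obtain ⟨ℓ, hℓc, hℓ, v, rfl⟩ := hW
  refine ⟨continuous_whittakerArch hℓc v, ?_⟩
  obtain ⟨N, C, hC0, hC⟩ := exists_whittaker_bound hℓc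
  obtain ⟨D, A, hD0, hD⟩ := exists_norm_torus_le hπ
  obtain ⟨x₀, hx₀⟩ := hψ
  set η : ℝ := ‖(ψ x₀ : ℂ) - 1‖ with hη
  have hη0 : 0 < η := by
    rw [hη, norm_pos_iff, sub_ne_zero]
    exact fun e => hx₀ (Circle.ext e)
  have key : ∀ M : ℕ, ∃ E : ℝ, 0 ≤ E ∧ ∀ k ∈ unitaryGL 𝕜, ∀ (a : 𝕜ˣ) (h : 𝕜), ‖h‖ ≤ ‖x₀‖ →
      ‖((ψ (a * h) : ℂ) - 1) ^ M * ℓ (smoothRep π (diagOne a * k) v)‖ ≤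
        E * absMax a ^ (A + N) * ‖h‖ ^ M := by
    intro M
    choose E hE0 hE using fun j => exists_norm_orbitDeriv_fwdDiff_le (π := π) j M v ‖x₀‖
    refine ⟨C * ∑ j ∈ Finset.range (N + 1), D * E j,
      mul_nonneg hC0 (Finset.sum_nonneg fun j _ => mul_nonneg hD0 (hE0 j)), fun k hk a h hh => ?_⟩
    rw [← whittaker_fwdDiff hℓ]
    refine (hC _).trans ?_
    rw [mul_assoc, mul_assoc, Finset.sum_mul]
    refine mul_le_mul_of_nonneg_left (Finset.sum_le_sum fun j hj => ?_) hC0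
    refine (norm_orbitDeriv_diagOne_le j _ a).trans ?_
    have h1 := one_le_absMax a
    have hm := absMax_pos a
    have hjN : j ≤ N := Nat.lt_succ_iff.1 (Finset.mem_range.1 hj)
    have hEj := hE0 j
    calc _ ≤ (D * absMax a ^ A) * ((E j * ‖h‖ ^ M) * absMax a ^ N) := by
          gcongr
          · exact hD a
          · exact hE j k hk h hh
      _ = D * E j * (absMax a ^ (A + N) * ‖h‖ ^ M) := by ring
  -- Without differences this is the growth bound: exponent A from the operator norm and N from the
  -- order of the seminorms.
  obtain ⟨E₀, hE₀, h₀⟩ := key 0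
  refine ⟨A + N, fun M => ?_⟩
  -- A + N of the differences cancel that growth, and M remain for the decay.
  obtain ⟨E₁, hE₁, h₁⟩ := key (M + (A + N))
  set M' := M + (A + N) with hM'
  set E₂ : ℝ := E₁ * ‖x₀‖ ^ M' / η ^ M' with hE₂
  have hE₂0 : 0 ≤ E₂ := by positivity
  refine ⟨max E₀ E₂, le_max_of_le_left hE₀, fun k hk a => ⟨fun _ => ?_, fun ha => ?_⟩⟩
  · have h := h₀ k hk a 0 (by simp)
    rw [pow_zero, one_mul, pow_zero, mul_one] at h
    have := absMax_pos a
    exact h.trans (by gcongr; exact le_max_left _ _)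
  · have ha0 := norm_unit_pos a
    -- For this step ψ(ah) = ψ(x₀), so the factor is η^M', independent of a, while ‖h‖ = ‖x₀‖/‖a‖
    -- gives the decay.
    have h := h₁ k hk a (x₀ / a) (by
      rw [norm_div]
      exact div_le_self (norm_nonneg _) ha)
    rw [mul_div_cancel₀ _ a.ne_zero, norm_mul, norm_pow, norm_div, ← absMax_of_one_le ha,
      div_pow] at h
    have hm := absMax_pos a
    refine le_max_of_le_right ?_
    rw [hE₂, le_div_iff₀ (pow_pos hη0 _)]
    have hpow : 0 < absMax a ^ (A + N) := pow_pos hm _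
    have h2 := mul_le_mul_of_nonneg_right h (pow_pos hm M).le
    calc ‖ℓ (smoothRep π (diagOne a * k) v)‖ * absMax a ^ M * η ^ M'
        = η ^ M' * ‖ℓ (smoothRep π (diagOne a * k) v)‖ * absMax a ^ M := by ring
      _ ≤ E₁ * absMax a ^ (A + N) * (‖x₀‖ ^ M' / absMax a ^ M') * absMax a ^ M := h2
      _ = E₁ * ‖x₀‖ ^ M' * (absMax a ^ M' / absMax a ^ M') := by
        rw [hM', pow_add (absMax a) M]
        ring
      _ = E₁ * ‖x₀‖ ^ M' := by rw [div_self (pow_pos hm _).ne', mul_one]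

theorem isRapidlyDecreasing_of_schwartzArch
    {f : Matrix (Fin 2) (Fin 2) 𝕜 × Matrix (Fin 2) (Fin 2) 𝕜 → ℂ} (hf : IsSchwartzArch f) :
    Continuous f ∧ IsRapidlyDecreasing f := by
  obtain ⟨φ, hφ⟩ := hf
  constructor
  · have hfun : f = fun p => φ (Matrix.of.symm p.1, Matrix.of.symm p.2) :=
      funext fun p => hφ p.1 p.2
    rw [hfun]
    have h1 : Continuous fun X : Matrix (Fin 2) (Fin 2) 𝕜 =>
        (Matrix.of.symm X : Fin 2 → Fin 2 → 𝕜) := continuous_id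
    exact φ.continuous.comp ((h1.comp continuous_fst).prodMk (h1.comp continuous_snd))
  · intro P
    -- Each entry size is at most 4n, and 1 + 4n + 4n ≤ 8(1 + n); the factor 2^P comes from the
    -- seminorm estimate for (1 + n)^P.
    refine ⟨8 ^ P * (2 ^ P * ((Finset.Iic (P, 0)).sup
      fun m => SchwartzMap.seminorm ℝ m.1 m.2) φ), fun X Y => ?_⟩
    have h := SchwartzMap.one_add_le_sup_seminorm_apply (𝕜 := ℝ) (m := (P, 0)) (k := P) (n := 0)
      le_rfl le_rfl φ (Matrix.of.symm X, Matrix.of.symm Y)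
    rw [norm_iteratedFDeriv_zero] at h
    set n : ℝ := ‖((Matrix.of.symm X, Matrix.of.symm Y) :
      (Fin 2 → Fin 2 → 𝕜) × (Fin 2 → Fin 2 → 𝕜))‖ with hn
    have hentry : ∀ (Z : Fin 2 → Fin 2 → 𝕜), entrySize (Matrix.of Z) ≤ 4 * ‖Z‖ := by
      intro Z
      have hZ : ∀ i j, ‖Z i j‖ ≤ ‖Z‖ := fun i j =>
        (norm_le_pi_norm (Z i) j).trans (norm_le_pi_norm Z i)
      simp only [entrySize, Fin.sum_univ_two, Matrix.of_apply]
      linarith [hZ 0 0, hZ 0 1, hZ 1 0, hZ 1 1]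
    have hX : entrySize X ≤ 4 * n := (hentry (Matrix.of.symm X)).trans
      (mul_le_mul_of_nonneg_left (le_max_left _ _) (by norm_num))
    have hY : entrySize Y ≤ 4 * n := (hentry (Matrix.of.symm Y)).trans
      (mul_le_mul_of_nonneg_left (le_max_right _ _) (by norm_num))
    have hX0 := entrySize_nonneg X
    have hY0 := entrySize_nonneg Y
    rw [hφ]
    calc _ ≤ ‖φ (Matrix.of.symm X, Matrix.of.symm Y)‖ * (8 * (1 + n)) ^ P := by
          gcongr
          linarith
      _ = 8 ^ P * ((1 + n) ^ P * ‖φ (Matrix.of.symm X, Matrix.of.symm Y)‖) := by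
          rw [mul_pow]; ring
      _ ≤ _ := by gcongr

end Arch

end ZetaTwo

/-! ### The theorem at non-archimedean and archimedean places -/

theorem mainTheorem9 :
    -- non-archimedean places
    (∀ (F : Type*) [NontriviallyNormedField F] [IsUltrametricDist F] [LocallyCompactSpace F]
      [CharZero F] [MeasurableSpace F] [BorelSpace F]
      [MeasurableSpace (ZetaTwo.integralGL F)] [BorelSpace (ZetaTwo.integralGL F)]
      (dx : Measure F) [dx.IsAddHaarMeasure] (dt : Measure Fˣ) [dt.IsHaarMeasure]
      (dk : Measure (ZetaTwo.integralGL F)) [dk.IsHaarMeasure]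
      (ψ : AddChar F Circle) (_ : Continuous ψ) (_ : ∃ x, ψ x ≠ 1)
      (V₁ V₂ : Type*) [AddCommGroup V₁] [Module ℂ V₁] [AddCommGroup V₂] [Module ℂ V₂]
      (π₁ : Representation ℂ (GL (Fin 2) F) V₁) (π₂ : Representation ℂ (GL (Fin 2) F) V₂)
      (_ : π₁.IsIrreducible) (_ : π₂.IsIrreducible)
      (_ : ZetaTwo.IsAdmissibleNA π₁) (_ : ZetaTwo.IsAdmissibleNA π₂)
      (ω₁ ω₂ : Fˣ →ₜ* ℂˣ)
      (_ : ZetaTwo.IsCentralCharacter π₁ ω₁) (_ : ZetaTwo.IsCentralCharacter π₂ ω₂)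
      (_ : ∀ z, ω₁ z * ω₂ z = 1) (μ : Fˣ →ₜ* ℂˣ),
      ∀ W₁ ∈ ZetaTwo.whittakerNA π₁ ψ, ∀ W₂ ∈ ZetaTwo.whittakerNA π₂ ψ,
        ∃ c : ℝ, ∀ f, ZetaTwo.IsSchwartzBruhatNA f →
          ∀ s₁ s₂ : ℂ, c < s₁.re → c < s₂.re →
            ZetaTwo.ZetaConvergesAbsolutely dx dt dk ψ ω₂ μ W₁ W₂ f s₁ s₂) ∧
    -- archimedean places
    (∀ (𝕜 : Type*) [RCLike 𝕜]
      [MeasurableSpace (ZetaTwo.unitaryGL 𝕜)] [BorelSpace (ZetaTwo.unitaryGL 𝕜)]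
      (dx : Measure 𝕜) [dx.IsAddHaarMeasure] (dt : Measure 𝕜ˣ) [dt.IsHaarMeasure]
      (dk : Measure (ZetaTwo.unitaryGL 𝕜)) [dk.IsHaarMeasure]
      (ψ : AddChar 𝕜 Circle) (_ : Continuous ψ) (_ : ∃ x, ψ x ≠ 1)
      (H₁ H₂ : Type*) [NormedAddCommGroup H₁] [NormedSpace ℂ H₁] [CompleteSpace H₁]
      [NormedAddCommGroup H₂] [NormedSpace ℂ H₂] [CompleteSpace H₂]
      (π₁ : GL (Fin 2) 𝕜 →* (H₁ →L[ℂ] H₁)) (π₂ : GL (Fin 2) 𝕜 →* (H₂ →L[ℂ] H₂))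
      (_ : ZetaTwo.IsIrreducibleAdmissibleArch π₁) (_ : ZetaTwo.IsIrreducibleAdmissibleArch π₂)
      (ω₁ ω₂ : 𝕜ˣ →ₜ* ℂˣ)
      (_ : ZetaTwo.IsCentralCharacterArch π₁ ω₁) (_ : ZetaTwo.IsCentralCharacterArch π₂ ω₂)
      (_ : ∀ z, ω₁ z * ω₂ z = 1) (μ : 𝕜ˣ →ₜ* ℂˣ),
      ∀ W₁ ∈ ZetaTwo.whittakerArch π₁ ψ, ∀ W₂ ∈ ZetaTwo.whittakerArch π₂ ψ,
        ∃ c : ℝ, ∀ f, ZetaTwo.IsSchwartzArch f →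
          ∀ s₁ s₂ : ℂ, c < s₁.re → c < s₂.re →
            ZetaTwo.ZetaConvergesAbsolutely dx dt dk ψ ω₂ μ W₁ W₂ f s₁ s₂) := by
  refine ⟨?_, ?_⟩
  · intro F _ _ _ _ _ _ _ _ dx _ dt _ dk _ ψ hψ hψ1 V₁ V₂ _ _ _ _ π₁ π₂ _ _ h₁ h₂ ω₁ ω₂ _ _ _ μ
      W₁ hW₁ W₂ hW₂
    have : ProperSpace F := .of_locallyCompactSpace F
    obtain ⟨hc₁, hd₁⟩ := ZetaTwo.hasTorusDecay_of_mem_whittakerNA h₁ hψ hψ1 hW₁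
    obtain ⟨hc₂, hd₂⟩ := ZetaTwo.hasTorusDecay_of_mem_whittakerNA h₂ hψ hψ1 hW₂
    obtain ⟨c, hc⟩ := ZetaTwo.zetaConvergesAbsolutely_of_hasTorusDecay (F := F)
      (K := ZetaTwo.integralGL F) (fun _ hk => hk.1) dx dt dk hψ ω₂ μ hc₁ hc₂ hd₁ hd₂
    refine ⟨c, fun f hf => ?_⟩
    obtain ⟨hfc, hfd⟩ := ZetaTwo.isRapidlyDecreasing_of_schwartzBruhatNA hf
    exact hc f hfc hfd
  · intro 𝕜 _ _ _ dx _ dt _ dk _ ψ hψ hψ1 H₁ H₂ _ _ _ _ _ _ π₁ π₂ h₁ h₂ ω₁ ω₂ _ _ _ μ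
      W₁ hW₁ W₂ hW₂
    obtain ⟨hc₁, hd₁⟩ := ZetaTwo.hasTorusDecay_of_mem_whittakerArch h₁.continuous hψ1 hW₁
    obtain ⟨hc₂, hd₂⟩ := ZetaTwo.hasTorusDecay_of_mem_whittakerArch h₂.continuous hψ1 hW₂
    obtain ⟨c, hc⟩ := ZetaTwo.zetaConvergesAbsolutely_of_hasTorusDecay (F := 𝕜)
      (K := ZetaTwo.unitaryGL 𝕜) ZetaTwo.unitaryGL_bounded dx dt dk hψ ω₂ μ hc₁ hc₂ hd₁ hd₂
    refine ⟨c, fun f hf => ?_⟩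
    obtain ⟨hfc, hfd⟩ := ZetaTwo.isRapidlyDecreasing_of_schwartzArch hf
    exact hc f hfc hfd
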